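/- A structural matrix is a matrix with entries in $\{0,\ast\}$. Let $\mathbb{F}$ be $\mathbb{R}$ or $\mathbb{C}$. A matrix $X$ over $\mathbb{F}$ has the non-zero structure of a structural matrix $\mathcal{X}$ of the same dimensions if $X_{i,j}\neq 0$ is equivalent to $\mathcal{X}_{i,j}=\ast$ for all $i,j$. A pair of structural matrices $\mathcal{A}\in\{0,\ast\}^{n\times n}$, $\mathcal{B}\in\{0,\ast\}^{n\times r}$ is strong structurally controllable if for all matrices $A$, $B$ over $\mathbb{F}$ having the non-zero structure of $\mathcal{A}$ and $\mathcal{B}$, respectively, the system $\dot x(t)=Ax(t)+Bu(t)$ is controllable, i.e., for any initial state $x_0\in\mathbb{F}^n$ and any terminal state $x_1\in\mathbb{F}^n$ there are $T>0$ and a measurable, essentially bounded input signal $u\colon[0,T]\to\mathbb{F}^r$ that steers the system from $x_0$ at time $0$ to $x_1$ at time $T$. Let $\mathcal{X}=(\mathcal{A},\mathcal{B})\in\{0,\ast\}^{n\times(n+r)}$, $n\ge 1$, have $\nu$ $\ast$-entries. A compressed column storage of $\mathcal{X}$ consists of two integer arrays, $i_s$ of length $n+r+1$ and $s$ of length $\nu$,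 such that, for $1\le j\le n+r+1$, $i_s(j)-1$ is the number of $\ast$-entries in the first $j-1$ columns of $\mathcal{X}$, and, for $1\le i\le n$ and $1\le j\le n+r$, $\mathcal{X}_{i,j}=\ast$ if and only if $s(k)=i$ for some $k$ with $i_s(j)\le k<i_s(j+1)$. **Theorem.** Strong structural controllability of a pair of structural matrices can be verified with time complexity $\mathcal{O}(n+r+\nu)$. That is, there are one program for a random access machine and one constant $C$ such that for all $n\geq 1$, $r\ge 0$, every pair $(\mathcal{A},\mathcal{B})\in\{0,\ast\}^{n\times(n+r)}$ with $\nu$ $\ast$-entries, and every compressed column storage $(s,i_s)$ of $(\mathcal{A},\mathcal{B})$, the program, given $n$, $r$, $i_s$ and $s$ in its memory, halts after at most $C\,(n+r+\nu)$ steps with output $1$ if $(\mathcal{A},\mathcal{B})$ is strong structurally controllable and with output $0$ otherwise; the same program serves both $\mathbb{F}=\mathbb{R}$ and $\mathbb{F}=\mathbb{C}$. Here the machine has finitely many registers and an indirectly addressed memory, all holding natural numbers. Each of the following is one step: loading a constant, copying a register, adding or subtracting (with negative results replaced by $0$) two registers, reading or writing the memory cell whose address is in a register, doing nothing, and testing whether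 a register is positive in an if- or while-statement. No number that the program computes exceeds $C\,(n+r+\nu)$. -/

import Mathlib

/-! ## Linear systems and strong structural controllability -/

/-- A structural matrix, i.e. an element of `{0, ∗}^{n × m}`: `true` stands for `∗`, `false` for `0`. -/
abbrev StructMatrix (n m : ℕ) : Type := Matrix (Fin n) (Fin m) Bool

/-- `X` has the non-zero structure of `𝒳`: `X i j ≠ 0` exactly at the `∗`-entries of `𝒳`. -/
def HasNonzeroStructure {𝔽 : Type*} [Zero 𝔽] {n m : ℕ}
    (X : Matrix (Fin n) (Fin m) 𝔽) (𝒳 : StructMatrix n m) : Prop :=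
  ∀ i j, X i j ≠ 0 ↔ 𝒳 i j = true

/-- The input `u` (measurable and essentially bounded on `[0, T]`) steers the system
`x' = A x + B u` from the state `x₀` at time `0` to the state `x₁` at time `T`:
the corresponding (Carathéodory) solution `x` on `[0, T]` starts in `x₀` and ends in `x₁`. -/
def Steers {𝔽 : Type*} [RCLike 𝔽] {n r : ℕ}
    (A : Matrix (Fin n) (Fin n) 𝔽) (B : Matrix (Fin n) (Fin r) 𝔽)
    (x₀ x₁ : Fin n → 𝔽) (T : ℝ) (u : ℝ → Fin r → 𝔽) : Prop :=
  MeasureTheory.MemLp u ⊤ (MeasureTheory.volume.restrict (Set.Icc 0 T)) ∧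
  ∃ x : ℝ → Fin n → 𝔽,
    ContinuousOn x (Set.Icc 0 T) ∧
    (∀ t ∈ Set.Icc 0 T,
      x t = x₀ + ∫ τ in (0 : ℝ)..t, (A.mulVec (x τ) + B.mulVec (u τ))) ∧
    x T = x₁

/-- The system `x' = A x + B u` is controllable: any initial state can be steered to any
terminal state in some time `T > 0` by some input signal. -/
def IsControllable {𝔽 : Type*} [RCLike 𝔽] {n r : ℕ}
    (A : Matrix (Fin n) (Fin n) 𝔽) (B : Matrix (Fin n) (Fin r) 𝔽) : Prop :=
  ∀ x₀ x₁ : Fin n → 𝔽, ∃ T : ℝ, 0 < T ∧ ∃ u : ℝ → Fin r → 𝔽, Steers A B x₀ x₁ T u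

/-- `(𝒜, ℬ)` is strong structurally controllable over `𝔽`: every pair of matrices over `𝔽` with
the non-zero structure of `(𝒜, ℬ)` is controllable. -/
def StrongStructControllable (𝔽 : Type*) [RCLike 𝔽] {n r : ℕ}
    (𝒜 : StructMatrix n n) (ℬ : StructMatrix n r) : Prop :=
  ∀ (A : Matrix (Fin n) (Fin n) 𝔽) (B : Matrix (Fin n) (Fin r) 𝔽),
    HasNonzeroStructure A 𝒜 → HasNonzeroStructure B ℬ → IsControllable A B

/-! ## Sparse representation -/

/-- The `n × (n + r)` structural matrix `(𝒜, ℬ)`. -/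
def pairMatrix {n r : ℕ} (𝒜 : StructMatrix n n) (ℬ : StructMatrix n r) : StructMatrix n (n + r) :=
  fun i => Fin.append (𝒜 i) (ℬ i)

/-- The number of `∗`-entries in the first `j` columns of `𝒳`. -/
def starsBefore {n m : ℕ} (𝒳 : StructMatrix n m) (j : ℕ) : ℕ :=
  (Finset.univ.filter fun p : Fin n × Fin m => (p.2 : ℕ) < j ∧ 𝒳 p.1 p.2 = true).card

/-- The number `ν` of `∗`-entries of `𝒳`. -/
def numStars {n m : ℕ} (𝒳 : StructMatrix n m) : ℕ :=
  (Finset.univ.filter fun p : Fin n × Fin m => 𝒳 p.1 p.2 = true).card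

/-- The integer arrays `colPtr` (of length `m + 1`) and `rowIdx` (of length `ν`) are a compressed
column storage of `𝒳`. Rows, columns and array positions are numbered from `1`, as the array
entries; so the entry in position `k` of an array `a` is `a[k - 1]?`, and the row `i : Fin n` has
number `i + 1`. The order of the row indices inside a column is arbitrary. -/
def IsCCS {n m : ℕ} (𝒳 : StructMatrix n m) (colPtr rowIdx : List ℕ) : Prop :=
  colPtr.length = m + 1 ∧
  rowIdx.length = numStars 𝒳 ∧
  (∀ j, j ≤ m → colPtr[j]? = some (starsBefore 𝒳 j + 1)) ∧
  (∀ (i : Fin n) (j : Fin m), 𝒳 i j = true ↔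
    ∃ k, starsBefore 𝒳 j + 1 ≤ k ∧ k < starsBefore 𝒳 (j + 1) + 1 ∧
      rowIdx[k - 1]? = some ((i : ℕ) + 1))

/-! ## Random access machine

Goto-free programs of a unit-cost random access machine. Addition and (truncated) subtraction are
the only arithmetic operations. -/

namespace RAM

/-- Registers (a program names finitely many of them) and a memory that is addressed indirectly. -/
structure State where
  reg : ℕ → ℕ
  mem : ℕ → ℕ

/-- The state with the value of register `a` replaced by `v`. -/
def State.setReg (σ : State) (a v : ℕ) : State :=
  { σ with reg := Function.update σ.reg a v }

/-- The state with the content of memory cell `a` replaced by `v`. -/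
def State.setMem (σ : State) (a v : ℕ) : State :=
  { σ with mem := Function.update σ.mem a v }

/-- Start state: the input occupies the memory cells `0, 1, …`; everything else is `0`. -/
def State.init (input : List ℕ) : State where
  reg := fun _ => 0
  mem := fun a => input.getD a 0

/-- Programs; `a`, `b`, `d` are names of registers. -/
inductive Prog : Type
  /-- no operation -/
  | skip : Prog
  /-- `d := c` -/
  | const (d c : ℕ) : Prog
  /-- `d := a` -/
  | copy (d a : ℕ) : Prog
  /-- `d := a + b` -/
  | add (d a b : ℕ) : Prog
  /-- `d := max (a - b) 0` -/
  | sub (d a b : ℕ) : Prog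
  /-- `d := mem[a]` -/
  | load (d a : ℕ) : Prog
  /-- `mem[a] := b` -/
  | store (a b : ℕ) : Prog
  /-- first `p`, then `q` -/
  | seq (p q : Prog) : Prog
  /-- if `a > 0` then `p` else `q` -/
  | cond (a : ℕ) (p q : Prog) : Prog
  /-- while `a > 0` do `p` -/
  | loop (a : ℕ) (p : Prog) : Prog

/-- `Exec W p σ t σ'`: on a machine whose words hold the numbers `0, …, W`, the program `p`, started
in the state `σ`, halts after exactly `t` steps in the state `σ'`. Each operation and each test is
one step. An operation whose result does not fit into a word cannot be executed. -/
inductive Exec (W : ℕ) : Prog → State → ℕ → State → Prop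
  | skip (σ : State) : Exec W Prog.skip σ 1 σ
  | const (d c : ℕ) (σ : State) : c ≤ W →
      Exec W (Prog.const d c) σ 1 (σ.setReg d c)
  | copy (d a : ℕ) (σ : State) :
      Exec W (Prog.copy d a) σ 1 (σ.setReg d (σ.reg a))
  | add (d a b : ℕ) (σ : State) : σ.reg a + σ.reg b ≤ W →
      Exec W (Prog.add d a b) σ 1 (σ.setReg d (σ.reg a + σ.reg b))
  | sub (d a b : ℕ) (σ : State) :
      Exec W (Prog.sub d a b) σ 1 (σ.setReg d (σ.reg a - σ.reg b))
  | load (d a : ℕ) (σ : State) : σ.mem (σ.reg a) ≤ W →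
      Exec W (Prog.load d a) σ 1 (σ.setReg d (σ.mem (σ.reg a)))
  | store (a b : ℕ) (σ : State) :
      Exec W (Prog.store a b) σ 1 (σ.setMem (σ.reg a) (σ.reg b))
  | seq (p q : Prog) (σ σ' σ'' : State) (t t' : ℕ) : Exec W p σ t σ' → Exec W q σ' t' σ'' →
      Exec W (Prog.seq p q) σ (t + t') σ''
  | cond_pos (a : ℕ) (p q : Prog) (σ σ' : State) (t : ℕ) : 0 < σ.reg a → Exec W p σ t σ' →
      Exec W (Prog.cond a p q) σ (t + 1) σ'
  | cond_zero (a : ℕ) (p q : Prog) (σ σ' : State) (t : ℕ) : σ.reg a = 0 → Exec W q σ t σ' →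
      Exec W (Prog.cond a p q) σ (t + 1) σ'
  | loop_zero (a : ℕ) (p : Prog) (σ : State) : σ.reg a = 0 →
      Exec W (Prog.loop a p) σ 1 σ
  | loop_pos (a : ℕ) (p : Prog) (σ σ' σ'' : State) (t t' : ℕ) : 0 < σ.reg a →
      Exec W p σ t σ' → Exec W (Prog.loop a p) σ' t' σ'' →
      Exec W (Prog.loop a p) σ (t + t' + 1) σ''

end RAM

/-! The pair is strong structurally controllable if and only if, for `d = 0` and `d = 1`, every
nonempty set `V` of rows has a column `j` in which the number of stars in the rows `V`, increased by
`d` if `j` is itself an index in `V`, equals `1` (`IsPeelable`). The criterion does not mention the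
field, so one program serves `ℝ` and `ℂ`.

Necessity: if `V` violates the condition, nonzero entries can be chosen such that the indicator
vector of `V` is a left eigenvector of `A` with eigenvalue `d` that annihilates `B`. Indeed, each
column asks for nonzero numbers with a prescribed sum `0` or `1`, which fails only for one number
with sum `0` or for no number with sum `1`. Such an eigenvector excludes controllability.
Sufficiency: by the Kalman condition and an eigenvector argument over `ℂ`, an uncontrollable pair
has a left eigenvector that annihilates `B`. Its support `V`, with `d = 0` exactly for eigenvalue
`0`, contradicts the condition in the column `j`. See `strongStructControllable_iff`.

Both conditions merge into one for the block diagonal matrix with blocks `𝒳` and `𝒳 + I`, seen as a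
bipartite multigraph with `2 n` rows, `2 m` columns (`m = n + r`) and `2 ν + n` edges. That
condition is tested greedily: as long as some column has exactly one edge in the remaining rows, the
row of that edge is deleted. A set that violates the condition never loses a row, and the rows that
remain at the end violate it unless there are none; so the condition holds exactly if every row is
deleted (`exec_peel`).

For linear time, candidate columns are kept on a stack, the edges of each row form a linked list,
and each column stores its number of remaining edges and the sum of their rows. Once the number is
`1`, the sum is the row sought. Sums are reduced modulo `2 n` to keep the words small. Each edge is
removed at most once and causes at most one push, so twice the number of live edges plus the height
of the stack decreases in each step. -/

namespace RAM

/-! ## Weakest preconditions -/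

/-- Weakest precondition of a loop-free program on a machine with word bound `W`. -/
def Prog.wp (W : ℕ) : Prog → (State → Prop) → State → Prop
  | .skip, Q, σ => Q σ
  | .const d c, Q, σ => c ≤ W ∧ Q (σ.setReg d c)
  | .copy d a, Q, σ => Q (σ.setReg d (σ.reg a))
  | .add d a b, Q, σ => σ.reg a + σ.reg b ≤ W ∧ Q (σ.setReg d (σ.reg a + σ.reg b))
  | .sub d a b, Q, σ => Q (σ.setReg d (σ.reg a - σ.reg b))
  | .load d a, Q, σ => σ.mem (σ.reg a) ≤ W ∧ Q (σ.setReg d (σ.mem (σ.reg a)))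
  | .store a b, Q, σ => Q (σ.setMem (σ.reg a) (σ.reg b))
  | .seq p q, Q, σ => p.wp W (q.wp W Q) σ
  | .cond a p q, Q, σ => (0 < σ.reg a → p.wp W Q σ) ∧ (σ.reg a = 0 → q.wp W Q σ)
  | .loop _ _, _, _ => False

/-- An upper bound for the running time of a loop-free program. -/
def Prog.len : Prog → ℕ
  | .seq p q => p.len + q.len
  | .cond _ p q => p.len + q.len + 1
  | _ => 1

theorem Prog.exec_of_wp {W : ℕ} {p : Prog} {Q : State → Prop} {σ : State} (h : p.wp W Q σ) :
    ∃ t τ, Exec W p σ t τ ∧ t ≤ p.len ∧ Q τ := by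
  induction p generalizing Q σ with
  | skip => exact ⟨_, _, .skip σ, le_rfl, h⟩
  | const d c => exact ⟨_, _, .const d c σ h.1, le_rfl, h.2⟩
  | copy d a => exact ⟨_, _, .copy d a σ, le_rfl, h⟩
  | add d a b => exact ⟨_, _, .add d a b σ h.1, le_rfl, h.2⟩
  | sub d a b => exact ⟨_, _, .sub d a b σ, le_rfl, h⟩
  | load d a => exact ⟨_, _, .load d a σ h.1, le_rfl, h.2⟩
  | store a b => exact ⟨_, _, .store a b σ, le_rfl, h⟩
  | seq p q ihp ihq =>
    obtain ⟨t, τ, hp, ht, h'⟩ := ihp h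
    obtain ⟨t', τ', hq, ht', h''⟩ := ihq h'
    exact ⟨_, _, .seq p q _ _ _ _ _ hp hq, Nat.add_le_add ht ht', h''⟩
  | cond a p q ihp ihq =>
    rcases Nat.eq_zero_or_pos (σ.reg a) with ha | ha
    · obtain ⟨t, τ, hq, ht, h'⟩ := ihq (h.2 ha)
      exact ⟨_, _, .cond_zero a p q _ _ _ ha hq, by simp only [Prog.len]; omega, h'⟩
    · obtain ⟨t, τ, hq, ht, h'⟩ := ihp (h.1 ha)
      exact ⟨_, _, .cond_pos a p q _ _ _ ha hq, by simp only [Prog.len]; omega, h'⟩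
  | loop a p => exact h.elim

/-- A loop whose body is loop-free and decreases a potential. -/
theorem exec_loop {W a : ℕ} {p : Prog} (I : ℕ → State → Prop)
    (hI : ∀ φ σ, I φ σ → 0 < σ.reg a → p.wp W (fun τ => ∃ φ' < φ, I φ' τ) σ) :
    ∀ φ σ, I φ σ → ∃ t τ, Exec W (.loop a p) σ t τ ∧ t ≤ (p.len + 1) * φ + 1 ∧
      τ.reg a = 0 ∧ ∃ φ', I φ' τ := by
  intro φ
  induction φ using Nat.strong_induction_on with
  | _ φ ih =>
    intro σ h
    rcases Nat.eq_zero_or_pos (σ.reg a) with ha | ha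
    · exact ⟨1, σ, .loop_zero a p σ ha, by omega, ha, φ, h⟩
    · obtain ⟨t, τ, hp, ht, φ', hφ', h'⟩ := Prog.exec_of_wp (hI φ σ h ha)
      obtain ⟨t', τ', hl, ht', h''⟩ := ih φ' hφ' τ h'
      refine ⟨_, τ', .loop_pos a p _ _ _ _ _ ha hp hl, ?_, h''⟩
      have : (p.len + 1) * φ' + (p.len + 1) ≤ (p.len + 1) * φ := by
        rw [← Nat.mul_succ]; exact Nat.mul_le_mul_left _ hφ'
      omega

/-! ## Arrays -/

/-- The memory whose cells below `B` are given by `low`, and whose cells from `B` on hold the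
entries of eight interleaved arrays. -/
def layout (B : ℕ) (low : ℕ → ℕ) (A : ℕ → ℕ → ℕ) : ℕ → ℕ :=
  fun a => if a < B then low a else A ((a - B) % 8) ((a - B) / 8)

theorem layout_low {B : ℕ} {low : ℕ → ℕ} {A : ℕ → ℕ → ℕ} {a : ℕ} (h : a < B) :
    layout B low A a = low a := if_pos h

/-- The stride is a power of two because there is no multiplication: three doublings and one
addition of a base yield an address. Only the arrays `0, …, 5` are used. -/
theorem layout_cell {B : ℕ} {low : ℕ → ℕ} {A : ℕ → ℕ → ℕ} {q : ℕ} (hq : q < 8) (i : ℕ) :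
    layout B low A (8 * i + (B + q)) = A q i := by
  have h1 : (8 * i + (B + q) - B) % 8 = q := by omega
  have h2 : (8 * i + (B + q) - B) / 8 = i := by omega
  rw [layout, if_neg (by omega), h1, h2]

theorem update_layout {B : ℕ} {low : ℕ → ℕ} {A : ℕ → ℕ → ℕ} {q : ℕ} (hq : q < 8) (i v : ℕ) :
    Function.update (layout B low A) (8 * i + (B + q)) v =
      layout B low (Function.update A q (Function.update (A q) i v)) := by
  funext a
  by_cases ha : a = 8 * i + (B + q)
  · subst ha
    rw [layout_cell hq]; simp
  · rw [Function.update_of_ne ha]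
    unfold layout
    split_ifs with h
    · rfl
    · by_cases h1 : (a - B) % 8 = q
      · rw [h1, Function.update_self, Function.update_of_ne (by omega)]
      · rw [Function.update_of_ne h1]

infixr:60 " ;; " => RAM.Prog.seq

/-- Put into register `1` the address of entry `reg i` of array `q`. -/
def address (q i : ℕ) : Prog :=
  .add 1 i i ;; .add 1 1 1 ;; .add 1 1 1 ;; .add 1 1 (20 + q)

/-- Read entry `reg i` of array `q` into register `d`. -/
def readArr (q d i : ℕ) : Prog := address q i ;; .load d 1

/-- Write register `b` to entry `reg i` of array `q`. -/
def writeArr (q i b : ℕ) : Prog := address q i ;; .store 1 b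

/-- Register `3` holds `1`, registers `20, …, 25` hold the addresses of the arrays. -/
structure Bases (B : ℕ) (g : ℕ → ℕ) : Prop where
  one : g 3 = 1
  base : ∀ q < 6, g (20 + q) = B + q

theorem Bases.update {B : ℕ} {g : ℕ → ℕ} (h : Bases B g) {a : ℕ} (ha : a < 20 ∧ a ≠ 3) (v : ℕ) :
    Bases B (Function.update g a v) :=
  ⟨by rw [Function.update_of_ne ha.2.symm]; exact h.one,
    fun q hq => by rw [Function.update_of_ne (by omega)]; exact h.base q hq⟩

theorem wp_readArr {W B q d i : ℕ} {g low : ℕ → ℕ} {A : ℕ → ℕ → ℕ} {Q : State → Prop}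
    (hq : q < 6) (hg : g (20 + q) = B + q) (hW : 8 * g i + (B + q) ≤ W) (hA : A q (g i) ≤ W)
    (hQ : Q ⟨Function.update (Function.update g 1 (8 * g i + (B + q))) d (A q (g i)),
      layout B low A⟩) :
    (readArr q d i).wp W Q ⟨g, layout B low A⟩ := by
  have e : g i + g i + (g i + g i) + (g i + g i + (g i + g i)) + (B + q) = 8 * g i + (B + q) := by
    ring
  have h1 : 20 + q ≠ 1 := by omega
  simp only [readArr, address, Prog.wp, State.setReg, Function.update_self, Function.update_idem,
    Function.update_of_ne h1, hg, e, layout_cell (show q < 8 by omega)]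
  exact ⟨by omega, by omega, by omega, hW, hA, hQ⟩

theorem wp_writeArr {W B q i b : ℕ} {g low : ℕ → ℕ} {A : ℕ → ℕ → ℕ} {Q : State → Prop}
    (hq : q < 6) (hg : g (20 + q) = B + q) (hb : b ≠ 1) (hW : 8 * g i + (B + q) ≤ W)
    (hQ : Q ⟨Function.update g 1 (8 * g i + (B + q)),
      layout B low (Function.update A q (Function.update (A q) (g i) (g b)))⟩) :
    (writeArr q i b).wp W Q ⟨g, layout B low A⟩ := by
  have e : g i + g i + (g i + g i) + (g i + g i + (g i + g i)) + (B + q) = 8 * g i + (B + q) := by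
    ring
  have h1 : 20 + q ≠ 1 := by omega
  simp only [writeArr, address, Prog.wp, State.setReg, State.setMem, Function.update_self,
    Function.update_idem, Function.update_of_ne h1, Function.update_of_ne hb, hg, e,
    update_layout (show q < 8 by omega)]
  exact ⟨by omega, by omega, by omega, hW, hQ⟩

theorem wp_seq {W : ℕ} {p q : Prog} {Q : State → Prop} :
    (p ;; q).wp W Q = p.wp W (q.wp W Q) := rfl

/-! ## Edge lists -/

/-- The last of the edges `1, …, e` in row `i`, or `0` if there is none; edge `ε + 1` is in row
`ro ε`. -/
def lastEdge (ro : ℕ → ℕ) (i : ℕ) : ℕ → ℕ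
  | 0 => 0
  | e + 1 => if ro e = i then e + 1 else lastEdge ro i e

theorem lastEdge_le (ro : ℕ → ℕ) (i e : ℕ) : lastEdge ro i e ≤ e := by
  induction e with
  | zero => exact le_rfl
  | succ e ih => unfold lastEdge; split_ifs <;> omega

/-- Within a row, moving the bound down to the last edge of that row skips no edge of the row. Hence
following a link of a row list discards exactly one edge, and starting at the head discards none. -/
theorem lt_lastEdge_iff {ro : ℕ → ℕ} {i e ε : ℕ} (h : ro ε = i) :
    ε < lastEdge ro i e ↔ ε < e := by
  induction e with
  | zero => rfl
  | succ e ih =>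
    unfold lastEdge
    split_ifs with h1
    · rfl
    · have : ε ≠ e := by rintro rfl; exact h1 h
      omega

theorem row_lastEdge (ro : ℕ → ℕ) (i e : ℕ) :
    lastEdge ro i e = 0 ∨ ro (lastEdge ro i e - 1) = i := by
  induction e with
  | zero => exact .inl rfl
  | succ e ih =>
    unfold lastEdge
    split_ifs with h1
    · exact .inr h1
    · exact ih

theorem lastEdge_congr {ro ro' : ℕ → ℕ} {i e : ℕ} (h : ∀ ε < e, ro ε = ro' ε) :
    lastEdge ro i e = lastEdge ro' i e := by
  induction e with
  | zero => rfl
  | succ e ih =>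
    unfold lastEdge
    rw [h e (by omega), ih fun ε hε => h ε (by omega)]

/-- The arrays `0`, `1`, `2` store, for the edges `1, …, e` with rows `ro` and columns `co`, the
last edge of each row, the previous edge in the row, and the column of each edge. -/
structure StoresEdges (N M e : ℕ) (ro co : ℕ → ℕ) (A : ℕ → ℕ → ℕ) : Prop where
  row_lt : ∀ ε < e, ro ε < N
  col_lt : ∀ ε < e, co ε < M
  head : ∀ i, A 0 i = lastEdge ro i e
  next : ∀ ε < e, A 1 (ε + 1) = lastEdge ro (ro ε) ε
  col : ∀ ε < e, A 2 (ε + 1) = co ε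

/-- The arrays `3`, `4` store, for each column, the number of edges in `L` and the sum of their
rows modulo `N`. -/
structure StoresCounts (N : ℕ) (L : Finset ℕ) (ro co : ℕ → ℕ) (A : ℕ → ℕ → ℕ) : Prop where
  count : ∀ j, A 3 j = ∑ ε ∈ L, if co ε = j then 1 else 0
  sum : ∀ j, A 4 j = (∑ ε ∈ L, if co ε = j then ro ε else 0) % N

/-- Reduce register `2` modulo register `6`, provided that it is less than twice that number. -/
def reduceMod : Prog :=
  .add 18 2 3 ;; .sub 18 18 6 ;; .cond 18 (.sub 2 2 6) .skip

theorem wp_reduceMod {W : ℕ} {g mem : ℕ → ℕ} {Q : State → Prop} (h3 : g 3 = 1)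
    (h : g 2 < 2 * g 6) (hW : g 2 + 1 ≤ W)
    (hQ : ∀ x, Q ⟨Function.update (Function.update g 18 x) 2 (g 2 % g 6), mem⟩) :
    reduceMod.wp W Q ⟨g, mem⟩ := by
  simp only [reduceMod, Prog.wp, State.setReg, Function.update_self, Function.update_idem, h3]
  -- Register `18` holds the truncated difference `g 2 + 1 - g 6`, which is positive exactly if `g 2
  -- ≥ g 6`.
  refine ⟨hW, fun h1 => ?_, fun h1 => ?_⟩ <;> simp at h1 ⊢
  · convert hQ _ using 4
    rw [Nat.mod_eq_sub_mod (by omega), Nat.mod_eq_of_lt (by omega)]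
  · convert hQ (g 2 + 1 - g 6) using 2
    rw [Nat.mod_eq_of_lt (by omega)]
    symm
    rw [Function.update_eq_self_iff]
    simp

/-- Append an edge with row `reg 16` and column `reg 15` to the `reg 10` edges stored. -/
def addEdge : Prog :=
  .add 10 10 3 ;; readArr 0 2 16 ;; writeArr 1 10 2 ;; writeArr 0 16 10 ;; writeArr 2 10 15 ;;
  readArr 3 2 15 ;; .add 2 2 3 ;; writeArr 3 15 2 ;;
  readArr 4 2 15 ;; .add 2 2 16 ;; reduceMod ;; writeArr 4 15 2

/-- Push register `15` on the stack. -/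
def push : Prog := writeArr 5 11 15 ;; .add 11 11 3

theorem wp_push {W B : ℕ} {g low : ℕ → ℕ} {A : ℕ → ℕ → ℕ} {Q : State → Prop}
    (hg : Bases B g) (hW : 8 * g 11 + B + 5 ≤ W)
    (hQ : ∀ x, Q ⟨Function.update (Function.update g 1 x) 11 (g 11 + 1),
      layout B low (Function.update A 5 (Function.update (A 5) (g 11) (g 15)))⟩) :
    push.wp W Q ⟨g, layout B low A⟩ := by
  rw [push, wp_seq]
  refine wp_writeArr (by norm_num) (hg.base 5 (by norm_num)) (by norm_num) (by omega) ?_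
  simp [Prog.wp, State.setReg, hg.one]
  exact ⟨by omega, hQ _⟩

/-- The new edge has index `g 10` and number `g 10 + 1`, as `0` serves as the null link. It becomes
the head of the list of its row, linked to the former head. -/
theorem wp_addEdge {W B N M : ℕ} {g low ro co : ℕ → ℕ} {A : ℕ → ℕ → ℕ} {Q : State → Prop}
    (hg : Bases B g) (h6 : g 6 = N) (hr : g 16 < N) (hc : g 15 < M)
    (hW : 8 * (N + M + g 10 + 1) + B + 5 ≤ W)
    (hE : StoresEdges N M (g 10) ro co A) (hC : StoresCounts N (Finset.range (g 10)) ro co A)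
    (hQ : ∀ g' A', (∀ a, a ≠ 1 → a ≠ 2 → a ≠ 10 → a ≠ 18 → g' a = g a) → g' 10 = g 10 + 1 →
      A' 5 = A 5 →
      StoresEdges N M (g 10 + 1) (Function.update ro (g 10) (g 16))
        (Function.update co (g 10) (g 15)) A' →
      StoresCounts N (Finset.range (g 10 + 1)) (Function.update ro (g 10) (g 16))
        (Function.update co (g 10) (g 15)) A' →
      Q ⟨g', layout B low A'⟩) :
    addEdge.wp W Q ⟨g, layout B low A⟩ := by
  have b0 : g 20 = B := hg.base 0 (by norm_num)
  have b1 : g 21 = B + 1 := hg.base 1 (by norm_num)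
  have b2 : g 22 = B + 2 := hg.base 2 (by norm_num)
  have b3 : g 23 = B + 3 := hg.base 3 (by norm_num)
  have b4 : g 24 = B + 4 := hg.base 4 (by norm_num)
  have h3 : g 3 = 1 := hg.one
  have hN : 0 < N := by omega
  -- Every value that is read is at most the number of edges or less than `N`, so the arithmetic
  -- stays within the word bound.
  have hh : A 0 (g 16) ≤ g 10 := by rw [hE.head]; exact lastEdge_le _ _ _
  have hcount : A 3 (g 15) ≤ g 10 := by
    rw [hC.count]
    calc _ ≤ ∑ ε ∈ Finset.range (g 10), 1 := by
          gcongr; split_ifs <;> omega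
      _ = g 10 := by simp
  have hsum : A 4 (g 15) < N := by rw [hC.sum]; exact Nat.mod_lt _ hN
  have hupd : ∀ (f : ℕ → ℕ) (v : ℕ), ∀ ε ∈ Finset.range (g 10),
      Function.update f (g 10) v ε = f ε := fun f v ε hε =>
    Function.update_of_ne (by have := Finset.mem_range.1 hε; omega) _ _
  simp only [addEdge, wp_seq]
  refine ⟨by simp only [h3]; omega, ?_⟩
  simp only [State.setReg, h3]
  refine wp_readArr (by norm_num) (by simp [b0]) (by simp; omega) (by simp; omega) ?_
  refine wp_writeArr (by norm_num) (by simp [b1]) (by norm_num) (by simp; omega) ?_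
  refine wp_writeArr (by norm_num) (by simp [b0]) (by norm_num) (by simp; omega) ?_
  refine wp_writeArr (by norm_num) (by simp [b2]) (by norm_num) (by simp; omega) ?_
  refine wp_readArr (by norm_num) (by simp [b3]) (by simp; omega) (by simp; omega) ?_
  refine ⟨by simp [h3]; omega, ?_⟩
  simp only [State.setReg]
  refine wp_writeArr (by norm_num) (by simp [b3]) (by norm_num) (by simp; omega) ?_
  refine wp_readArr (by norm_num) (by simp [b4]) (by simp; omega) (by simp; omega) ?_
  refine ⟨by simp; omega, ?_⟩
  simp only [State.setReg]
  refine wp_reduceMod (by simp [h3]) (by simp [h6]; omega) (by simp; omega) fun x => ?_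
  refine wp_writeArr (by norm_num) (by simp [b4]) (by norm_num) (by simp; omega) ?_
  simp [h3, h6]
  refine hQ _ _ ?_ (by simp) (by simp) ⟨?_, ?_, ?_, ?_, ?_⟩ ⟨?_, ?_⟩
  · intro a h1 h2 h10 h18
    simp [h1, h2, h10, h18]
  · intro ε hε
    rcases Nat.lt_succ_iff_lt_or_eq.1 hε with h | rfl
    · rw [hupd _ _ _ (Finset.mem_range.2 h)]; exact hE.row_lt _ h
    · simpa using hr
  · intro ε hε
    rcases Nat.lt_succ_iff_lt_or_eq.1 hε with h | rfl
    · rw [hupd _ _ _ (Finset.mem_range.2 h)]; exact hE.col_lt _ h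
    · simpa using hc
  · intro i
    have : lastEdge (Function.update ro (g 10) (g 16)) i (g 10) = lastEdge ro i (g 10) :=
      lastEdge_congr fun ε hε => hupd _ _ _ (Finset.mem_range.2 hε)
    simp only [lastEdge, this, Function.update_self]
    rcases eq_or_ne i (g 16) with rfl | h
    · simp
    · simp [h, h.symm, hE.head]
  · intro ε hε
    rcases Nat.lt_succ_iff_lt_or_eq.1 hε with h | rfl
    · rw [hupd _ _ _ (Finset.mem_range.2 h), lastEdge_congr (ro' := ro) fun ε' hε' =>
        hupd _ _ _ (Finset.mem_range.2 (hε'.trans h))]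
      simp [hE.next ε h, h.ne]
    · rw [lastEdge_congr (ro' := ro) fun ε' hε' => hupd _ _ _ (Finset.mem_range.2 hε')]
      simp [hE.head]
  · intro ε hε
    rcases Nat.lt_succ_iff_lt_or_eq.1 hε with h | rfl
    · rw [hupd _ _ _ (Finset.mem_range.2 h)]
      simp [hE.col ε h, h.ne]
    · simp
  · intro j
    rw [Finset.sum_range_succ, Finset.sum_congr rfl fun ε hε => by rw [hupd _ _ ε hε]]
    rw [← hC.count]
    rcases eq_or_ne j (g 15) with rfl | h
    · simp
    · simp [h, h.symm]
  · intro j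
    rw [Finset.sum_range_succ, Finset.sum_congr rfl fun ε hε => by rw [hupd _ _ ε hε, hupd _ _ ε hε]]
    rcases eq_or_ne j (g 15) with rfl | h
    · simp [hC.sum]
    · simp [h, h.symm, hC.sum]

/-! ## Peeling

Repeatedly, a column with a single edge in the remaining rows is chosen and the row of that edge is
removed. -/

/-- Push register `15` on the stack if register `19` holds `1`. -/
def pushIf : Prog := .sub 18 19 3 ;; .cond 19 (.cond 18 .skip push) .skip

/-- The new stack `T` and registers `g'` are left abstract, so that a caller continues with one
proof for both outcomes. -/
theorem wp_pushIf {W B : ℕ} {g low : ℕ → ℕ} {A : ℕ → ℕ → ℕ} {Q : State → Prop}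
    (hg : Bases B g) (hW : 8 * g 11 + B + 5 ≤ W)
    (hQ : ∀ g' T, (∀ a, a ≠ 1 → a ≠ 11 → a ≠ 18 → g' a = g a) →
      (g 19 = 1 → g' 11 = g 11 + 1 ∧ T = Function.update (A 5) (g 11) (g 15)) →
      (g 19 ≠ 1 → g' 11 = g 11 ∧ T = A 5) →
      Q ⟨g', layout B low (Function.update A 5 T)⟩) :
    pushIf.wp W Q ⟨g, layout B low A⟩ := by
  have h3 := hg.one
  simp only [pushIf, Prog.wp, State.setReg, Function.update_self]
  refine ⟨fun h19 => ⟨fun h18 => ?_, fun h18 => ?_⟩, fun h19 => ?_⟩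
  · simp [h3] at h19 h18
    have := hQ (Function.update g 18 (g 19 - g 3)) (A 5) (fun a _ _ h => by simp [h])
      (by omega) (by simp)
    simpa using this
  · simp [h3] at h19 h18
    refine wp_push ⟨by simp [h3], fun q hq => ?_⟩ (by simp; omega) fun x => ?_
    · rw [Function.update_of_ne (by omega)]; exact hg.base q hq
    · refine hQ _ _ (fun a h1 h11 h => by simp [h1, h11, h]) (fun _ => ⟨by simp, by simp⟩)
        (by omega)
  · simp [h3] at h19
    have := hQ (Function.update g 18 (g 19 - g 3)) (A 5) (fun a _ _ h => by simp [h])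
      (by omega) (by simp)
    simpa using this

/-- Remove edge `reg 12`, which is in row `reg 13`. -/
def removeEdge : Prog :=
  readArr 2 15 12 ;; readArr 3 19 15 ;; .sub 19 19 3 ;; writeArr 3 15 19 ;;
  readArr 4 2 15 ;; .add 2 2 6 ;; .sub 2 2 13 ;; reduceMod ;; writeArr 4 15 2 ;;
  readArr 1 12 12 ;; pushIf

/-- Pop a column; if it has a single edge, begin to remove the row of that edge. -/
def popColumn : Prog :=
  .sub 11 11 3 ;; readArr 5 15 11 ;; readArr 3 2 15 ;; .sub 18 2 3 ;;
  .cond 2 (.cond 18 .skip (readArr 4 13 15 ;; readArr 0 12 13 ;; .sub 14 14 3)) .skip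

/-- The body of the peeling loop. -/
def peelBody : Prog := .cond 12 removeEdge popColumn ;; .add 17 12 11

/-- The edges in the rows `R` together with the edges `1, …, cur` in row `row`. -/
def liveEdges (E : ℕ) (ro : ℕ → ℕ) (R : Finset ℕ) (row cur : ℕ) : Finset ℕ :=
  (Finset.range E).filter fun ε => ro ε ∈ R ∨ ro ε = row ∧ ε < cur

/-- The number of edges in the rows `V` and the column `j`. -/
def edgeCount (E : ℕ) (ro co : ℕ → ℕ) (V : Finset ℕ) (j : ℕ) : ℕ :=
  ∑ ε ∈ Finset.range E, if ro ε ∈ V ∧ co ε = j then 1 else 0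

/-- Invariant of the peeling loop, with remaining rows `R` and potential `φ`. -/
structure PeelInv (B N M E : ℕ) (ro co : ℕ → ℕ) (R : Finset ℕ) (φ : ℕ) (g : ℕ → ℕ)
    (A : ℕ → ℕ → ℕ) : Prop where
  bases : Bases B g
  numRows : g 6 = N
  edges : StoresEdges N M E ro co A
  counts : StoresCounts N (liveEdges E ro R (g 13) (g 12)) ro co A
  rows_subset : R ⊆ Finset.range N
  row_notMem : g 12 = 0 ∨ g 13 ∉ R
  cur_le : g 12 ≤ E
  cur_row : g 12 = 0 ∨ ro (g 12 - 1) = g 13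
  potential : 2 * (liveEdges E ro R (g 13) (g 12)).card + g 11 ≤ φ
  size : (liveEdges E ro R (g 13) (g 12)).card + g 11 ≤ E + M
  stack_lt : ∀ s < g 11, A 5 s < M
  complete : ∀ j < M, A 3 j = 1 → (∃ s < g 11, A 5 s = j) ∨ ∃ ε < g 12, ro ε = g 13 ∧ co ε = j
  card_rows : g 14 = R.card
  maximal : ∀ V ⊆ Finset.range N, (∀ j < M, edgeCount E ro co V j ≠ 1) → V ⊆ R

/-- The removal erases one live edge and pushes at most one column, so the potential drops. Pushing
exactly when a count falls to `1` keeps `complete` true: a column with a single live edge is on the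
stack, or that edge is about to be removed with the current row. -/
theorem wp_removeEdge {W B N M E φ : ℕ} {ro co g low : ℕ → ℕ} {A : ℕ → ℕ → ℕ} {R : Finset ℕ}
    {Q : State → Prop} (hW : 8 * (N + M + E + 1) + B + 5 ≤ W)
    (h : PeelInv B N M E ro co R φ g A) (hcur : 0 < g 12)
    (hQ : ∀ φ' g' A', φ' < φ → PeelInv B N M E ro co R φ' g' A' → Q ⟨g', layout B low A'⟩) :
    removeEdge.wp W Q ⟨g, layout B low A⟩ := by
  have b0 : g 20 = B := h.bases.base 0 (by norm_num)
  have b1 : g 21 = B + 1 := h.bases.base 1 (by norm_num)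
  have b2 : g 22 = B + 2 := h.bases.base 2 (by norm_num)
  have b3 : g 23 = B + 3 := h.bases.base 3 (by norm_num)
  have b4 : g 24 = B + 4 := h.bases.base 4 (by norm_num)
  have h3 : g 3 = 1 := h.bases.one
  have h6 := h.numRows
  obtain ⟨c, hc⟩ : ∃ c, g 12 = c + 1 := ⟨g 12 - 1, by omega⟩
  have hcE : c < E := by have := h.cur_le; omega
  have hrow : ro c = g 13 := by simpa [hc] using h.cur_row
  have hrowN : g 13 < N := hrow ▸ h.edges.row_lt c hcE
  have hrowR : g 13 ∉ R := h.row_notMem.resolve_left (by omega)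
  have hcol : A 2 (c + 1) = co c := h.edges.col c hcE
  have hcolM : co c < M := h.edges.col_lt c hcE
  have hnext : A 1 (c + 1) = lastEdge ro (g 13) c := hrow ▸ h.edges.next c hcE
  have hnext_le : lastEdge ro (g 13) c ≤ c := lastEdge_le _ _ _
  set L := liveEdges E ro R (g 13) (g 12) with hL
  have hcL : c ∈ L := by
    simp only [hL, liveEdges, Finset.mem_filter, Finset.mem_range]
    exact ⟨hcE, .inr ⟨hrow, by omega⟩⟩
  -- Advancing the current edge along its row list erases precisely the edge `c` from the live ones.
  have hL' : liveEdges E ro R (g 13) (lastEdge ro (g 13) c) = L.erase c := by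
    ext ε
    simp only [hL, liveEdges, Finset.mem_filter, Finset.mem_range, Finset.mem_erase]
    by_cases hε : ro ε = g 13
    · rw [lt_lastEdge_iff hε, hε]
      simp only [hrowR, hc, true_and, false_or]
      omega
    · simp only [hε, false_and, or_false]
      have : ε ≠ c := by rintro rfl; exact hε hrow
      simp [this]
  have hcard : (L.erase c).card + 1 = L.card := Finset.card_erase_add_one hcL
  have hLE : L.card ≤ E := by
    simpa using Finset.card_le_card (show L ⊆ Finset.range E from Finset.filter_subset _ _)
  have hcount : A 3 (co c) ≤ E := by
    rw [h.counts.count]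
    calc _ ≤ ∑ ε ∈ L, 1 := by gcongr; split_ifs <;> omega
      _ ≤ E := by simpa using hLE
  have hsum : A 4 (co c) < N := by rw [h.counts.sum]; exact Nat.mod_lt _ (by omega)
  have hsize : L.card + g 11 ≤ E + M := h.size
  have hpot : 2 * L.card + g 11 ≤ φ := h.potential
  simp only [removeEdge, wp_seq]
  refine wp_readArr (by norm_num) (by simp [b2]) (by omega) (by rw [hc, hcol]; omega) ?_
  simp only [hc, hcol]
  refine wp_readArr (by norm_num) (by simp [b3]) (by simp; omega) (by simp; omega) ?_
  simp only [Prog.wp]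
  refine wp_writeArr (by norm_num) (by simp [b3]) (by norm_num) (by simp; omega) ?_
  refine wp_readArr (by norm_num) (by simp [b4]) (by simp; omega) (by simp; omega) ?_
  refine ⟨by simp [h6]; omega, ?_⟩
  simp only [State.setReg]
  refine wp_reduceMod (by simp [h3]) (by simp [h6]; omega) (by simp [h6]; omega) fun x => ?_
  refine wp_writeArr (by norm_num) (by simp [b4]) (by norm_num) (by simp; omega) ?_
  refine wp_readArr (by norm_num) (by simp [b1]) (by simp; omega)
    (by simp [hc, hnext]; omega) ?_
  refine wp_pushIf (by
    repeat refine Bases.update ?_ (by norm_num) _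
    exact h.bases) (by simp; omega) fun g' T hg' hp hn => ?_
  simp [h3, h6, hc, hnext] at hg' hp hn
  simp [h3, h6]
  have e : ∀ a, a ≠ 1 → a ≠ 2 → a ≠ 11 → a ≠ 12 → a ≠ 15 → a ≠ 18 → a ≠ 19 → g' a = g a := by
    intro a h1 h2 h11 h12 h15 h18 h19
    rw [hg' a h1 h11 h18]
    simp [*]
  have e12 : g' 12 = lastEdge ro (g 13) c := by rw [hg' 12] <;> simp
  have e13 : g' 13 = g 13 := by apply e <;> simp
  have e11 : g' 11 ≤ g 11 + 1 := by
    by_cases h1 : A 3 (co c) = 2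
    · exact (hp h1).1.le
    · exact (hn h1).1.le.trans (by omega)
  have hT : ∀ s < g' 11, T s < M := by
    intro s hs
    by_cases h1 : A 3 (co c) = 2
    · rw [(hp h1).1] at hs
      rw [(hp h1).2, Function.update_apply]
      split_ifs with h2
      · exact hcolM
      · exact h.stack_lt s (by omega)
    · rw [(hn h1).1] at hs
      rw [(hn h1).2]; exact h.stack_lt s hs
  refine hQ (φ - 1) _ _ (by omega) ⟨⟨?_, ?_⟩, ?_, ⟨?_, ?_, ?_, ?_, ?_⟩, ⟨?_, ?_⟩, ?_, ?_, ?_, ?_, ?_, ?_,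
    ?_, ?_, ?_, h.maximal⟩
  · rw [e] <;> simp [h3]
  · intro q hq
    rw [e _ (by omega) (by omega) (by omega) (by omega) (by omega) (by omega) (by omega)]
    exact h.bases.base q hq
  · rw [e] <;> simp [h6]
  · exact h.edges.row_lt
  · exact h.edges.col_lt
  · simpa using h.edges.head
  · simpa using h.edges.next
  · simpa using h.edges.col
  · intro j
    rw [e12, e13, hL']
    have h1 := h.counts.count j
    rw [← Finset.add_sum_erase _ _ hcL] at h1
    rcases eq_or_ne j (co c) with rfl | hj
    · simp at h1 ⊢; omega
    · simpa [hj, hj.symm] using h1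
  · intro j
    rw [e12, e13, hL']
    have h1 := h.counts.sum j
    rw [← Finset.add_sum_erase _ _ hcL] at h1
    rcases eq_or_ne j (co c) with rfl | hj
    · simp [hrow] at h1 ⊢
      rw [h1]
      generalize (∑ ε ∈ L.erase c, if co ε = co c then ro ε else 0) = s
      -- The program adds `N` before it subtracts the row; as `g 13 < N`, the truncated subtraction
      -- is exact.
      have : (g 13 + s) % N + N - g 13 = (g 13 + s) % N + (N - g 13) := by omega
      rw [this, Nat.mod_add_mod]
      have : g 13 + s + (N - g 13) = s + N := by omega
      rw [this, Nat.add_mod_right]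
    · simpa [hj, hj.symm] using h1
  · exact h.rows_subset
  · rw [e13]; exact .inr hrowR
  · omega
  · rw [e12, e13]; exact row_lastEdge _ _ _
  · rw [e12, e13, hL']; omega
  · rw [e12, e13, hL']; omega
  · simpa using hT
  · intro j hj h1
    rw [e12, e13]
    rcases eq_or_ne j (co c) with rfl | hne
    · simp at h1
      left
      refine ⟨g 11, by rw [(hp h1).1]; omega, ?_⟩
      simp [(hp h1).2]
    · simp [hne] at h1
      rcases h.complete j hj h1 with ⟨s, hs, hsj⟩ | ⟨ε, hε, hεr, hεc⟩
      · left
        by_cases h2 : A 3 (co c) = 2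
        · refine ⟨s, by rw [(hp h2).1]; omega, ?_⟩
          simp [(hp h2).2, hs.ne, hsj]
        · exact ⟨s, by rw [(hn h2).1]; omega, by simp [(hn h2).2, hsj]⟩
      · right
        refine ⟨ε, ?_, hεr, hεc⟩
        rw [lt_lastEdge_iff hεr]
        have : ε ≠ c := by rintro rfl; exact hne hεc.symm
        omega
  · rw [e] <;> simp [h.card_rows]

/-- A row leaves `R` at the same moment as its whole list becomes current. The live edges therefore
do not change, and the potential drops by the pop alone. -/
theorem wp_popColumn {W B N M E φ : ℕ} {ro co g low : ℕ → ℕ} {A : ℕ → ℕ → ℕ} {R : Finset ℕ}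
    {Q : State → Prop} (hW : 8 * (N + M + E + 1) + B + 5 ≤ W)
    (h : PeelInv B N M E ro co R φ g A) (hcur : g 12 = 0) (hsp : 0 < g 11)
    (hQ : ∀ R' φ' g' A', φ' < φ → PeelInv B N M E ro co R' φ' g' A' → Q ⟨g', layout B low A'⟩) :
    popColumn.wp W Q ⟨g, layout B low A⟩ := by
  have b0 : g 20 = B := h.bases.base 0 (by norm_num)
  have b3 : g 23 = B + 3 := h.bases.base 3 (by norm_num)
  have b4 : g 24 = B + 4 := h.bases.base 4 (by norm_num)
  have b5 : g 25 = B + 5 := h.bases.base 5 (by norm_num)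
  have h3 : g 3 = 1 := h.bases.one
  have h6 := h.numRows
  have hsize := h.size
  have hpot := h.potential
  obtain ⟨p, hp⟩ : ∃ p, g 11 = p + 1 := ⟨g 11 - 1, by omega⟩
  set j := A 5 p with hj
  have hjM : j < M := h.stack_lt p (by omega)
  set L := liveEdges E ro R (g 13) (g 12) with hL
  have hLr : ∀ ε, ε ∈ L ↔ ε < E ∧ ro ε ∈ R := by
    intro ε; simp [hL, liveEdges, hcur]
  have hLE : L.card ≤ E := by
    simpa using Finset.card_le_card (show L ⊆ Finset.range E from Finset.filter_subset _ _)
  have hcount : A 3 j ≤ E := by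
    rw [h.counts.count]
    calc _ ≤ ∑ ε ∈ L, 1 := by gcongr; split_ifs <;> omega
      _ ≤ E := by simpa using hLE
  -- A popped column whose count is not `1` can be forgotten: if its count falls to `1` later, it is
  -- pushed again.
  have hskip : ∀ g' : ℕ → ℕ, A 3 j ≠ 1 → (∀ a, a ≠ 1 → a ≠ 2 → a ≠ 11 → a ≠ 15 → a ≠ 18 →
      g' a = g a) → g' 11 = p → Q ⟨g', layout B low A⟩ := by
    intro g' h1 e e11
    have e12 : g' 12 = g 12 := by apply e <;> simp
    have e13 : g' 13 = g 13 := by apply e <;> simp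
    refine hQ R (φ - 1) g' A (by omega) ⟨⟨?_, ?_⟩, ?_, h.edges, ?_, h.rows_subset, ?_, ?_, ?_, ?_,
      ?_, ?_, ?_, ?_, h.maximal⟩
    · rw [e] <;> simp [h3]
    · intro q hq
      rw [e _ (by omega) (by omega) (by omega) (by omega) (by omega)]
      exact h.bases.base q hq
    · rw [e] <;> simp [h6]
    · rw [e12, e13]; exact h.counts
    · rw [e12, e13]; exact h.row_notMem
    · rw [e12]; exact h.cur_le
    · rw [e12, e13]; exact h.cur_row
    · rw [e12, e13, e11, ← hL]; omega
    · rw [e12, e13, e11, ← hL]; omega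
    · intro s hs; exact h.stack_lt s (by omega)
    · intro j' hj' hc
      rw [e12, e13, e11]
      rcases h.complete j' hj' hc with ⟨s, hs, hsj⟩ | h'
      · left
        refine ⟨s, ?_, hsj⟩
        have : s ≠ p := by rintro rfl; exact h1 (by rw [hj, hsj, hc])
        omega
      · exact .inr h'
    · rw [e] <;> simp [h.card_rows]
  simp only [popColumn, wp_seq]
  simp only [Prog.wp, State.setReg, hp, h3, Nat.add_sub_cancel]
  refine wp_readArr (by norm_num) (by simp [b5]) (by simp; omega) (by simp; omega) ?_
  refine wp_readArr (by norm_num) (by simp [b3]) (by simp; omega) (by simp [← hj]; omega) ?_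
  simp only [Function.update_self]
  refine ⟨fun hc0 => ⟨fun hc1 => ?_, fun hc1 => ?_⟩, fun hc0 => ?_⟩ <;> simp [h3, ← hj] at hc0
  · simp [h3, ← hj] at hc1
    exact hskip _ (by omega) (fun a h1 h2 h11 h15 h18 => by simp [*]) (by simp)
  · simp [h3, ← hj] at hc1
    have hone : A 3 j = 1 := by omega
    have hcnt := h.counts.count j
    rw [hone, ← Finset.card_filter, eq_comm, Finset.card_eq_one] at hcnt
    obtain ⟨ε, hε⟩ := hcnt
    obtain ⟨hεL, hεj⟩ := Finset.mem_filter.1 (hε ▸ Finset.mem_singleton_self ε :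
      ε ∈ L.filter fun ε => co ε = j)
    obtain ⟨hεE, hεR⟩ := (hLr ε).1 hεL
    -- With a single live edge in the column, the stored sum is the row of that edge, and the
    -- reduction modulo `N` does not affect it.
    have hrow : A 4 j = ro ε := by
      rw [h.counts.sum, ← Finset.sum_filter, hε, Finset.sum_singleton,
        Nat.mod_eq_of_lt (h.edges.row_lt ε hεE)]
    have hrN := h.edges.row_lt ε hεE
    have hhead : A 0 (ro ε) = lastEdge ro (ro ε) E := h.edges.head _
    have hhead_le : lastEdge ro (ro ε) E ≤ E := lastEdge_le _ _ _
    have hL' : liveEdges E ro (R.erase (ro ε)) (ro ε) (lastEdge ro (ro ε) E) = L := by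
      ext ε'
      rw [hLr]
      simp only [liveEdges, Finset.mem_filter, Finset.mem_range, Finset.mem_erase]
      by_cases hr : ro ε' = ro ε
      · rw [lt_lastEdge_iff hr, hr]; simp [hεR]
      · simp [hr]
    refine wp_readArr (by norm_num) (by simp [b4]) (by simp; omega)
      (by simp [← hj, hrow]; omega) ?_
    refine wp_readArr (by norm_num) (by simp [b0]) (by simp [← hj, hrow]; omega)
      (by simp [← hj, hrow, hhead]; omega) ?_
  
    refine hQ (R.erase (ro ε)) (φ - 1) _ _ (by omega) ⟨⟨?_, ?_⟩, ?_, h.edges, ?_, ?_, ?_, ?_, ?_,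
      ?_, ?_, ?_, ?_, ?_, ?_⟩
    · simp [h3]
    · intro q hq; interval_cases q <;> simp [b0, b3, b4, b5, h.bases.base 1, h.bases.base 2]
    · simp [h6]
    · simpa [← hj, hrow, hhead, hL'] using h.counts
    · exact (Finset.erase_subset _ _).trans h.rows_subset
    · simp [← hj, hrow]
    · simp [← hj, hrow, hhead]; omega
    · simpa [← hj, hrow, hhead] using row_lastEdge ro (ro ε) E
    · simp [← hj, hrow, hhead, hL']; omega
    · simp [← hj, hrow, hhead, hL']; omega
    · intro s hs
      simp at hs
      exact h.stack_lt s (by omega)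
    · intro j' hj' hc
      simp [← hj, hrow, hhead]
      rcases h.complete j' hj' hc with ⟨s, hs, hsj⟩ | ⟨ε', hε', _⟩
      -- The popped column is no longer on the stack; its only edge `ε` is now pending in the
      -- current row.
      · by_cases hsp : s = p
        · right
          refine ⟨ε, (lt_lastEdge_iff rfl).2 hεE, rfl, ?_⟩
          rw [hεj, ← hsj, hsp]
        · exact .inl ⟨s, by omega, hsj⟩
      · omega
    · simp [h3, h.card_rows, Finset.card_erase_of_mem hεR]
    · intro V hV hobs
      have hVR := h.maximal V hV hobs
      -- If an obstruction `V ⊆ R` contained the deleted row, column `j` would have exactly one edge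
      -- in `V`, as it has only one in `R`.
      refine Finset.subset_erase.2 ⟨hVR, fun hεV => hobs j hjM ?_⟩
      rw [edgeCount, ← Finset.card_filter, Finset.card_eq_one]
      refine ⟨ε, ?_⟩
      ext ε'
      simp only [Finset.mem_filter, Finset.mem_singleton]
      constructor
      · rintro ⟨h1, h2, h3⟩
        refine Finset.mem_singleton.1 (hε ▸ Finset.mem_filter.2 ⟨?_, h3⟩)
        exact (hLr ε').2 ⟨Finset.mem_range.1 h1, hVR h2⟩
      · rintro rfl
        exact ⟨Finset.mem_range.2 hεE, hεV, hεj⟩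
  · exact hskip _ (by omega) (fun a h1 h2 h11 h15 h18 => by simp [*]) (by simp)

theorem PeelInv.congr {B N M E φ : ℕ} {ro co g g' : ℕ → ℕ} {A : ℕ → ℕ → ℕ} {R : Finset ℕ}
    (h : PeelInv B N M E ro co R φ g A) (e : ∀ a, a ≠ 17 → g' a = g a) :
    PeelInv B N M E ro co R φ g' A := by
  refine ⟨⟨?_, ?_⟩, ?_, h.edges, ?_, h.rows_subset, ?_, ?_, ?_, ?_, ?_, ?_, ?_, ?_, h.maximal⟩
  · rw [e _ (by omega)]; exact h.bases.one
  · intro q hq; rw [e _ (by omega)]; exact h.bases.base q hq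
  all_goals simp only [e 6, e 11, e 12, e 13, e 14, ne_eq, Nat.reduceEqDiff, not_false_eq_true]
  · exact h.numRows
  · exact h.counts
  · exact h.row_notMem
  · exact h.cur_le
  · exact h.cur_row
  · exact h.potential
  · exact h.size
  · exact h.stack_lt
  · exact h.complete
  · exact h.card_rows

/-- When the loop ends, the stack is empty and no removal is pending, so no column has count `1`.
Thus the remaining set `R` is an obstruction if it is nonempty, and by `maximal` it contains every
other one. -/
theorem exec_peel {W B N M E φ : ℕ} {ro co g low : ℕ → ℕ} {A : ℕ → ℕ → ℕ} {R : Finset ℕ}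
    (hW : 8 * (N + M + E + 1) + B + 5 ≤ W)
    (h : PeelInv B N M E ro co R φ g A) (h17 : g 17 = g 12 + g 11) :
    ∃ t τ, Exec W (.loop 17 peelBody) ⟨g, layout B low A⟩ t τ ∧
      t ≤ (peelBody.len + 1) * φ + 1 ∧
      (τ.reg 14 = 0 ↔ ∀ V ⊆ Finset.range N, V.Nonempty → ∃ j < M, edgeCount E ro co V j = 1) := by
  obtain ⟨t, τ, hex, ht, h0, φ', g', A', R', hτ, h', hf⟩ := exec_loop (W := W) (a := 17)
    (p := peelBody)
    (fun φ σ => ∃ g A R, σ = ⟨g, layout B low A⟩ ∧ PeelInv B N M E ro co R φ g A ∧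
      g 17 = g 12 + g 11) (by
      rintro φ _ ⟨g, A, R, rfl, h, h17⟩ (hpos : 0 < g 17)
      rw [peelBody, wp_seq]
      have key : ∀ R' φ' g' A', φ' < φ → PeelInv B N M E ro co R' φ' g' A' →
          (Prog.add 17 12 11).wp W (fun τ => ∃ φ' < φ, ∃ g A R, τ = ⟨g, layout B low A⟩ ∧
            PeelInv B N M E ro co R φ' g A ∧ g 17 = g 12 + g 11) ⟨g', layout B low A'⟩ := by
        intro R' φ' g' A' hφ h'
        have := h'.cur_le
        have := h'.size
        refine ⟨by simp only; omega, φ', hφ, _, _, R', rfl,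
          h'.congr fun a ha => by simp [ha], by simp⟩
      refine ⟨fun h12 => ?_, fun h12 => ?_⟩
      · exact wp_removeEdge hW h h12 (key R)
      · exact wp_popColumn hW h h12 (by simp only at h12; omega) key) φ ⟨g, layout B low A⟩
    ⟨g, A, R, rfl, h, h17⟩
  refine ⟨t, τ, hex, ht, ?_⟩
  subst hτ
  simp only at h0 ⊢
  have h12 : g' 12 = 0 := by omega
  have h11 : g' 11 = 0 := by omega
  rw [h'.card_rows, Finset.card_eq_zero]
  constructor
  · rintro rfl V hV ⟨v, hv⟩
    by_contra! hcon
    exact absurd (h'.maximal V hV hcon hv) (Finset.notMem_empty _)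
  · intro hall
    by_contra hne
    obtain ⟨j, hj, hc⟩ := hall R' h'.rows_subset (Finset.nonempty_iff_ne_empty.2 hne)
    have : A' 3 j = 1 := by
      rw [h'.counts.count, liveEdges, Finset.sum_filter]
      simpa [h12, ite_and, edgeCount] using hc
    rcases h'.complete j hj this with ⟨s, hs, _⟩ | ⟨s, hs, _⟩ <;> omega

/-! ## Reading the input -/

/-- Store the two edges of entry `reg 9` of the input, which is in column `reg 8`. -/
def storeEntry : Prog :=
  .const 1 2 ;; .add 1 1 5 ;; .add 1 1 9 ;; .load 16 1 ;; .sub 16 16 3 ;; .copy 15 8 ;; addEdge ;;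
  .add 16 4 16 ;; .add 15 5 15 ;; addEdge ;; .add 9 9 3

/-- Push both copies of column `reg 8` on the stack, store its diagonal edge and go to the next
column. -/
def finishColumn : Prog :=
  .copy 15 8 ;; push ;; .add 15 5 15 ;; push ;; .sub 2 4 8 ;;
  .cond 2 (.add 16 4 8 ;; addEdge) .skip ;; .add 8 8 3 ;; .sub 17 5 8

/-- The body of the input loop. -/
def buildBody : Prog :=
  .const 1 3 ;; .add 1 1 8 ;; .load 2 1 ;; .sub 2 2 9 ;; .cond 2 storeEntry finishColumn

/-- The sum of `F` over the edges that arise from column `j` and the positions `k₀, …, k₁ - 1` of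
the row indices. -/
def entrySum (n m : ℕ) (s : ℕ → ℕ) (F : ℕ → ℕ → ℕ) (j k₀ k₁ : ℕ) : ℕ :=
  ∑ k ∈ Finset.Ico k₀ k₁, (F (s k) j + F (n + s k) (m + j))

/-- The sum of `F` over the edges that arise from the first `J` columns. -/
def columnSum (n m : ℕ) (sb s : ℕ → ℕ) (F : ℕ → ℕ → ℕ) (J : ℕ) : ℕ :=
  ∑ j ∈ Finset.range J,
    (entrySum n m s F j (sb j) (sb (j + 1)) + if j < n then F (n + j) (m + j) else 0)

/-- The contents of the input: column pointers `sb` and row indices `s`. -/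
structure InputData (n m ν : ℕ) (sb s : ℕ → ℕ) (low : ℕ → ℕ) : Prop where
  le : n ≤ m
  ptr_zero : sb 0 = 0
  ptr_last : sb m = ν
  ptr_mono : Monotone sb
  ptr : ∀ j < m, low (3 + j) = sb (j + 1) + 1
  row : ∀ k < ν, low (m + 3 + k) = s k + 1
  row_lt : ∀ k < ν, s k < n

/-- Invariant of the input loop after `J` columns and `K` entries. -/
structure BuildInv (B n m ν : ℕ) (sb s : ℕ → ℕ) (J K : ℕ) (ro co : ℕ → ℕ) (g : ℕ → ℕ)
    (A : ℕ → ℕ → ℕ) : Prop where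
  bases : Bases B g
  reg4 : g 4 = n
  reg5 : g 5 = m
  reg6 : g 6 = 2 * n
  reg8 : g 8 = J
  reg9 : g 9 = K + 1
  reg10 : g 10 = 2 * K + min J n
  reg11 : g 11 = 2 * J
  reg12 : g 12 = 0
  reg14 : g 14 = 2 * n
  reg17 : g 17 = m - J
  col_le : J ≤ m
  ptr_le : sb J ≤ K
  le_ptr : J < m → K ≤ sb (J + 1)
  le_entries : K ≤ ν
  edges : StoresEdges (2 * n) (2 * m) (2 * K + min J n) ro co A
  counts : StoresCounts (2 * n) (Finset.range (2 * K + min J n)) ro co A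
  stack : ∀ j < J, A 5 (2 * j) = j ∧ A 5 (2 * j + 1) = m + j
  sum : ∀ F : ℕ → ℕ → ℕ, ∑ ε ∈ Finset.range (2 * K + min J n), F (ro ε) (co ε) =
    columnSum n m sb s F J + entrySum n m s F J (sb J) K

/-- Sums of an arbitrary weight `F` over the edges describe the edges as a multiset, independently
of their order; this is how `BuildInv` records what has been stored. -/
theorem sum_update_edge (F : ℕ → ℕ → ℕ) (ro co : ℕ → ℕ) (e r c : ℕ) :
    ∑ ε ∈ Finset.range (e + 1), F (Function.update ro e r ε) (Function.update co e c ε) =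
      ∑ ε ∈ Finset.range e, F (ro ε) (co ε) + F r c := by
  rw [Finset.sum_range_succ, Function.update_self, Function.update_self]
  congr 1
  refine Finset.sum_congr rfl fun ε hε => ?_
  rw [Function.update_of_ne (Finset.mem_range.1 hε).ne,
    Function.update_of_ne (Finset.mem_range.1 hε).ne]

theorem wp_storeEntry {W B n m ν J K : ℕ} {sb s ro co g low : ℕ → ℕ} {A : ℕ → ℕ → ℕ}
    {Q : State → Prop} (hd : InputData n m ν sb s low) (hB : B = m + ν + 3)
    (hW : 8 * (2 * n + 2 * m + (2 * ν + n) + 1) + B + 5 ≤ W)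
    (h : BuildInv B n m ν sb s J K ro co g A) (hJ : J < m) (hK : K < sb (J + 1))
    (hQ : ∀ ro' co' g' A', BuildInv B n m ν sb s J (K + 1) ro' co' g' A' →
      Q ⟨g', layout B low A'⟩) :
    storeEntry.wp W Q ⟨g, layout B low A⟩ := by
  have hKν : K < ν := hK.trans_le (hd.ptr_last ▸ hd.ptr_mono hJ)
  have hs := hd.row_lt K hKν
  have hlow := hd.row K hKν
  have h3 := h.bases.one
  have h4 := h.reg4
  have h5 := h.reg5
  have h8 := h.reg8
  have h9 := h.reg9
  have h10 := h.reg10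
  have hmin : min J n ≤ n := min_le_right _ _
  have hE := h.edges
  have hC := h.counts
  rw [← h10] at hE hC
  -- The row indices follow `n`, `r` and the `m + 1` column pointers, hence start at address `m +
  -- 3`. Register `9` holds `K + 1`.
  have ha : 2 + m + (K + 1) = m + 3 + K := by ring
  simp only [storeEntry, wp_seq, Prog.wp, State.setReg, Function.update_self,
    Function.update_idem]
  simp [h3, h5, h8, h9, ha]
  rw [layout_low (by omega), hlow]
  refine ⟨by omega, by omega, by omega, by omega, ?_⟩
  refine wp_addEdge (N := 2 * n) (M := 2 * m) (ro := ro) (co := co) (by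
      repeat refine Bases.update ?_ (by norm_num) _
      exact h.bases)
    (by simp [h.reg6]) (by simp; omega) (by simp; omega) (by simp; omega)
    (by simpa using hE) (by simpa using hC)
    fun g₁ A₁ hg₁ h10₁ hA₁ hE₁ hC₁ => ?_
  have e₁ : ∀ a, a ≠ 1 → a ≠ 2 → a ≠ 10 → a ≠ 15 → a ≠ 16 → a ≠ 18 → g₁ a = g a := by
    intro a h1 h2 h10 h15 h16 h18
    rw [hg₁ a h1 h2 h10 h18]; simp [*]
  have e15 : g₁ 15 = J := by rw [hg₁] <;> simp
  have e16 : g₁ 16 = s K := by rw [hg₁] <;> simp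
  have e4 : g₁ 4 = n := by rw [e₁] <;> simp [h4]
  have e5 : g₁ 5 = m := by rw [e₁] <;> simp [h5]
  simp at h10₁ hE₁ hC₁
  refine ⟨by simp only [e16, e4]; omega, by simp [e15, e5]; omega, ?_⟩
  simp only [e4, e5, e15, e16]
  refine wp_addEdge (N := 2 * n) (M := 2 * m) (ro := Function.update ro (g 10) (s K))
    (co := Function.update co (g 10) J) ⟨?_, fun q hq => ?_⟩ ?_ (by simp; omega) (by simp; omega)
    (by simp; omega) (by simpa [h10₁] using hE₁) (by simpa [h10₁] using hC₁)
    fun g₂ A₂ hg₂ h10₂ hA₂ hE₂ hC₂ => ?_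
  · simp; rw [e₁] <;> simp [h3]
  · rw [Function.update_of_ne (by omega), Function.update_of_ne (by omega),
      e₁ _ (by omega) (by omega) (by omega) (by omega) (by omega) (by omega)]
    exact h.bases.base q hq
  · simp; rw [e₁] <;> simp [h.reg6]
  have e₂ : ∀ a, a ≠ 1 → a ≠ 2 → a ≠ 10 → a ≠ 15 → a ≠ 16 → a ≠ 18 → g₂ a = g a := by
    intro a h1 h2 h10 h15 h16 h18
    rw [hg₂ a h1 h2 h10 h18, ← e₁ a h1 h2 h10 h15 h16 h18]; simp [*]
  simp [h10₁] at h10₂ hE₂ hC₂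
  have e3 : g₂ 3 = 1 := by rw [e₂] <;> simp [h3]
  have e9 : g₂ 9 = K + 1 := by rw [e₂] <;> simp [h9]
  have e10 : g 10 + 1 + 1 = 2 * (K + 1) + min J n := by omega
  have e' : ∀ a, a ≠ 1 → a ≠ 2 → a ≠ 10 → a ≠ 15 → a ≠ 16 → a ≠ 18 → a ≠ 9 →
      Function.update g₂ 9 (g₂ 9 + g₂ 3) a = g a := by
    intro a h1 h2 h10 h15 h16 h18 h9
    rw [Function.update_of_ne h9, e₂ a h1 h2 h10 h15 h16 h18]
  refine ⟨by simp [e3, e9]; omega, hQ _ _ _ A₂ ⟨⟨?_, ?_⟩, ?_, ?_, ?_, ?_, ?_, ?_, ?_, ?_, ?_, ?_,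
    h.col_le, h.ptr_le.trans (Nat.le_succ _), fun _ => hK, hKν, e10 ▸ hE₂, e10 ▸ hC₂, ?_, ?_⟩⟩
  · rw [e'] <;> simp [h3]
  · intro q hq
    rw [e' _ (by omega) (by omega) (by omega) (by omega) (by omega) (by omega) (by omega)]
    exact h.bases.base q hq
  · rw [e'] <;> simp [h4]
  · rw [e'] <;> simp [h5]
  · rw [e'] <;> simp [h.reg6]
  · rw [e'] <;> simp [h8]
  · simp [e3, e9]
  · simp; omega
  · rw [e'] <;> simp [h.reg11]
  · rw [e'] <;> simp [h.reg12]
  · rw [e'] <;> simp [h.reg14]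
  · rw [e'] <;> simp [h.reg17]
  · rw [hA₂, hA₁]; exact h.stack
  · intro F
    rw [← e10, sum_update_edge, sum_update_edge, h10, h.sum, entrySum, entrySum,
      Finset.sum_Ico_succ_top h.ptr_le]
    ring

theorem wp_finishColumn {W B n m ν J K : ℕ} {sb s ro co g low : ℕ → ℕ} {A : ℕ → ℕ → ℕ}
    {Q : State → Prop} (hd : InputData n m ν sb s low)
    (hW : 8 * (2 * n + 2 * m + (2 * ν + n) + 1) + B + 5 ≤ W)
    (h : BuildInv B n m ν sb s J K ro co g A) (hJ : J < m) (hK : K = sb (J + 1))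
    (hQ : ∀ ro' co' g' A', BuildInv B n m ν sb s (J + 1) K ro' co' g' A' →
      Q ⟨g', layout B low A'⟩) :
    finishColumn.wp W Q ⟨g, layout B low A⟩ := by
  have h3 := h.bases.one
  have h4 := h.reg4
  have h5 := h.reg5
  have h8 := h.reg8
  have h10 := h.reg10
  have h11 := h.reg11
  have hnm := hd.le
  have hKν := h.le_entries
  have hmin : min J n ≤ n := min_le_right _ _
  -- The common end of both branches: a diagonal edge of `𝒳 + I` is added only for `J < n`.
  have hstep : ∀ ro' co' g' A', (∀ a, a ≠ 1 → a ≠ 2 → a ≠ 10 → a ≠ 11 → a ≠ 15 → a ≠ 16 → a ≠ 18 →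
      g' a = g a) → g' 10 = 2 * K + min (J + 1) n → g' 11 = 2 * (J + 1) →
      A' 5 = Function.update (Function.update (A 5) (2 * J) J) (2 * J + 1) (m + J) →
      StoresEdges (2 * n) (2 * m) (2 * K + min (J + 1) n) ro' co' A' →
      StoresCounts (2 * n) (Finset.range (2 * K + min (J + 1) n)) ro' co' A' →
      (∀ F : ℕ → ℕ → ℕ, ∑ ε ∈ Finset.range (2 * K + min (J + 1) n), F (ro' ε) (co' ε) =
        ∑ ε ∈ Finset.range (2 * K + min J n), F (ro ε) (co ε) +
          if J < n then F (n + J) (m + J) else 0) →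
      (Prog.add 8 8 3 ;; .sub 17 5 8).wp W Q ⟨g', layout B low A'⟩ := by
    intro ro' co' g' A' e e10 e11 eA hE hC hF
    have e3 : g' 3 = 1 := by rw [e] <;> simp [h3]
    have e5 : g' 5 = m := by rw [e] <;> simp [h5]
    have e8 : g' 8 = J := by rw [e] <;> simp [h8]
    simp only [Prog.wp, State.setReg, e3, e5, e8, ne_eq, Nat.reduceEqDiff,
      not_false_eq_true, Function.update_of_ne, Function.update_self]
    refine ⟨by omega, hQ ro' co' _ A' ⟨⟨?_, ?_⟩, ?_, ?_, ?_, ?_, ?_, ?_, ?_, ?_, ?_, ?_, hJ, hK.ge,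
      fun _ => hK.le.trans (hd.ptr_mono (Nat.le_succ _)), hKν, hE, hC, ?_, ?_⟩⟩
    · simp [e3]
    · intro q hq
      rw [Function.update_of_ne (by omega), Function.update_of_ne (by omega),
        e _ (by omega) (by omega) (by omega) (by omega) (by omega) (by omega) (by omega)]
      exact h.bases.base q hq
    · simp; rw [e] <;> simp [h4]
    · simp [e5]
    · simp; rw [e] <;> simp [h.reg6]
    · simp
    · simp; rw [e] <;> simp [h.reg9]
    · simp [e10]
    · simp [e11]
    · simp; rw [e] <;> simp [h.reg12]
    · simp; rw [e] <;> simp [h.reg14]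
    · simp
    · intro j hj
      rw [eA]
      rcases Nat.lt_succ_iff_lt_or_eq.1 hj with hj | rfl
      · have := h.stack j hj
        rw [Function.update_of_ne (by omega), Function.update_of_ne (by omega),
          Function.update_of_ne (by omega), Function.update_of_ne (by omega)]
        exact this
      · rw [Function.update_of_ne (by omega)]; simp
    · intro F
      rw [hF, h.sum, columnSum, columnSum, Finset.sum_range_succ, hK]
      simp only [entrySum, Finset.Ico_self, Finset.sum_empty]
      ring
  have hE := h.edges
  have hC := h.counts
  simp only [finishColumn, wp_seq] at hstep ⊢
  generalize (Prog.add 8 8 3).wp W ((Prog.sub 17 5 8).wp W Q) = Q' at hstep ⊢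
  simp only [Prog.wp, State.setReg, h8]
  refine wp_push (h.bases.update (by norm_num) _) (by simp; omega) fun x => ?_
  simp [h5, h11]
  refine ⟨by omega, wp_push (by
    repeat refine Bases.update ?_ (by norm_num) _
    exact h.bases) (by simp; omega) fun y => ?_⟩
  simp [h4, h8]
  refine ⟨fun hlt => ⟨by omega, ?_⟩, fun hle => ?_⟩
  · have e : min J n = J := min_eq_left hlt.le
    have e' : min (J + 1) n = J + 1 := min_eq_left hlt
    rw [e] at hE hC h10
    refine wp_addEdge (N := 2 * n) (M := 2 * m) (ro := ro) (co := co) (by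
        repeat refine Bases.update ?_ (by norm_num) _
        exact h.bases)
      (by simp [h.reg6]) (by simp; omega) (by simp; omega) (by simp; omega)
      ⟨?_, ?_, ?_, ?_, ?_⟩ ⟨?_, ?_⟩ fun g₁ A₁ hg₁ h10₁ hA₁ hE₁ hC₁ => ?_
    · simpa [h10] using hE.row_lt
    · simpa [h10] using hE.col_lt
    · simpa [h10] using hE.head
    · simpa [h10] using hE.next
    · simpa [h10] using hE.col
    · simpa [h10] using hC.count
    · simpa [h10] using hC.sum
    simp [h10] at h10₁ hE₁ hC₁
    have e10 : 2 * K + J + 1 = 2 * K + min (J + 1) n := by omega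
    refine hstep _ _ g₁ A₁ ?_ (by omega) ?_ (by rw [hA₁]; simp) (e10 ▸ hE₁) (e10 ▸ hC₁) ?_
    · intro a h1 h2 h10 h11 h15 h16 h18
      rw [hg₁ a h1 h2 h10 h18]; simp [*]
    · rw [hg₁] <;> simp; omega
    · intro F
      rw [← e10, sum_update_edge, e, if_pos hlt]
  · have e : min J n = n := min_eq_right (by omega)
    have e' : min (J + 1) n = n := min_eq_right (by omega)
    refine hstep ro co _ _ ?_ (by simp [h10, e, e']) (by simp; omega) (by simp) ?_ ?_ ?_
    · intro a h1 h2 h10 h11 h15 h16 h18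
      simp [*]
    · rw [e'.trans e.symm]
      exact ⟨hE.row_lt, hE.col_lt, by simpa using hE.head, by simpa using hE.next,
        by simpa using hE.col⟩
    · rw [e'.trans e.symm]
      exact ⟨by simpa using hC.count, by simpa using hC.sum⟩
    · intro F
      rw [e', e, if_neg (by omega), add_zero]

/-- Cell `3 + J` holds `sb (J + 1) + 1` and register `9` holds `K + 1`, so the tested difference is
positive exactly if column `J` has an unread entry. Each round consumes an entry or a column. -/
theorem wp_buildBody {W B n m ν J K : ℕ} {sb s ro co g low : ℕ → ℕ} {A : ℕ → ℕ → ℕ}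
    {Q : State → Prop} (hd : InputData n m ν sb s low) (hB : B = m + ν + 3)
    (hW : 8 * (2 * n + 2 * m + (2 * ν + n) + 1) + B + 5 ≤ W)
    (h : BuildInv B n m ν sb s J K ro co g A) (hpos : 0 < g 17)
    (hQ : ∀ J' K' ro' co' g' A', BuildInv B n m ν sb s J' K' ro' co' g' A' →
      (ν - K') + (m - J') < (ν - K) + (m - J) → Q ⟨g', layout B low A'⟩) :
    buildBody.wp W Q ⟨g, layout B low A⟩ := by
  rw [h.reg17] at hpos
  have hJ : J < m := by omega
  have hlow := hd.ptr J hJ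
  have hKs := h.le_ptr hJ
  have hsν : sb (J + 1) ≤ ν := hd.ptr_last ▸ hd.ptr_mono hJ
  have hupd : ∀ x y, BuildInv B n m ν sb s J K ro co
      (Function.update (Function.update g 1 x) 2 y) A := by
    intro x y
    refine ⟨(h.bases.update (by norm_num) _).update (by norm_num) _, ?_, ?_, ?_, ?_, ?_, ?_,
      ?_, ?_, ?_, ?_, h.col_le, h.ptr_le, h.le_ptr, h.le_entries, h.edges, h.counts, h.stack,
      h.sum⟩
    · simpa using h.reg4
    · simpa using h.reg5
    · simpa using h.reg6
    · simpa using h.reg8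
    · simpa using h.reg9
    · simpa using h.reg10
    · simpa using h.reg11
    · simpa using h.reg12
    · simpa using h.reg14
    · simpa using h.reg17
  simp only [buildBody, wp_seq]
  simp only [Prog.wp, State.setReg]
  simp [h.reg8, h.reg9]
  rw [layout_low (by omega), hlow]
  refine ⟨by omega, by omega, by omega, fun hlt => ?_, fun hle => ?_⟩
  · exact wp_storeEntry hd hB hW (hupd _ _) hJ (by omega) fun ro' co' g' A' h' =>
      hQ _ _ _ _ _ _ h' (by omega)
  · exact wp_finishColumn hd hW (hupd _ _) hJ (by omega) fun ro' co' g' A' h' =>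
      hQ _ _ _ _ _ _ h' (by omega)

theorem exec_build {W B n m ν : ℕ} {sb s ro co g low : ℕ → ℕ} {A : ℕ → ℕ → ℕ}
    (hd : InputData n m ν sb s low) (hB : B = m + ν + 3)
    (hW : 8 * (2 * n + 2 * m + (2 * ν + n) + 1) + B + 5 ≤ W)
    (h : BuildInv B n m ν sb s 0 0 ro co g A) :
    ∃ t ro' co' g' A', Exec W (.loop 17 buildBody) ⟨g, layout B low A⟩ t ⟨g', layout B low A'⟩ ∧
      t ≤ (buildBody.len + 1) * (ν + m) + 1 ∧ BuildInv B n m ν sb s m ν ro' co' g' A' := by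
  obtain ⟨t, τ, hex, ht, h0, φ', J, K, ro', co', g', A', rfl, h', -⟩ := exec_loop (W := W)
    (a := 17) (p := buildBody)
    (fun φ σ => ∃ J K ro co g A, σ = ⟨g, layout B low A⟩ ∧ BuildInv B n m ν sb s J K ro co g A ∧
      φ = (ν - K) + (m - J)) (by
      rintro _ _ ⟨J, K, ro, co, g, A, rfl, h, rfl⟩ (hpos : 0 < g 17)
      exact wp_buildBody hd hB hW h hpos fun J' K' ro' co' g' A' h' hlt =>
        ⟨_, hlt, J', K', ro', co', g', A', rfl, h', rfl⟩) (ν + m) ⟨g, layout B low A⟩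
    ⟨0, 0, ro, co, g, A, rfl, h, by simp⟩
  have h17 := h'.reg17
  rw [show g' 17 = 0 from h0] at h17
  have hJ : J = m := by have := h'.col_le; omega
  subst hJ
  have hK : K = ν := le_antisymm h'.le_entries (hd.ptr_last ▸ h'.ptr_le)
  subst hK
  exact ⟨t, ro', co', g', A', hex, ht, h'⟩

/-- Initialize the registers. -/
def setup : Prog :=
  .const 3 1 ;; .const 1 0 ;; .load 4 1 ;; .load 5 3 ;; .add 5 5 4 ;; .add 6 4 4 ;; .copy 14 6 ;;
  .const 1 2 ;; .add 1 1 5 ;; .load 2 1 ;; .add 20 2 5 ;; .const 1 2 ;; .add 20 20 1 ;;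
  .add 21 20 3 ;; .add 22 21 3 ;; .add 23 22 3 ;; .add 24 23 3 ;; .add 25 24 3 ;;
  .const 9 1 ;; .copy 17 5

/-- The number `ν` is not part of the input; it is read off the last column pointer, which locates
the end `B` of the input. Memory from there on is zero, which already represents empty lists and
zero counts, so nothing needs to be cleared. -/
theorem wp_setup {W B n r m ν : ℕ} {sb s low : ℕ → ℕ} {Q : State → Prop}
    (hd : InputData n m ν sb s low) (hm : m = n + r) (hn : 1 ≤ n) (h0 : low 0 = n) (h1 : low 1 = r)
    (hB : B = m + ν + 3) (hW : 8 * (2 * n + 2 * m + (2 * ν + n) + 1) + B + 5 ≤ W)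
    (hQ : ∀ g, BuildInv B n m ν sb s 0 0 (fun _ => 0) (fun _ => 0) g (fun _ _ => 0) →
      Q ⟨g, layout B low fun _ _ => 0⟩) :
    setup.wp W Q ⟨fun _ => 0, layout B low fun _ _ => 0⟩ := by
  have l0 : layout B low (fun _ _ => 0) 0 = n := by rw [layout_low (by omega), h0]
  have l1 : layout B low (fun _ _ => 0) 1 = r := by rw [layout_low (by omega), h1]
  have l2 : layout B low (fun _ _ => 0) (2 + m) = ν + 1 := by
    rw [layout_low (by omega)]
    have := hd.ptr (m - 1) (by omega)
    rwa [show 3 + (m - 1) = 2 + m by omega, show m - 1 + 1 = m by omega, hd.ptr_last] at this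
  have eB : ν + 1 + m + 2 = B := by omega
  have em : r + n = m := by omega
  simp only [setup, wp_seq]
  simp only [Prog.wp, State.setReg]
  simp [l0, l1, em, l2, eB]
  refine ⟨by omega, by omega, by omega, by omega, by omega, by omega, by omega, by omega, by omega,
    by omega, by omega, by omega, by omega, by omega, by omega, by omega, by omega, hQ _ ?_⟩
  refine ⟨⟨by simp, ?_⟩, by simp, by simp, by simp; omega, by simp, by simp, by simp, by simp,
    by simp, by simp; omega, by simp, by simp, by simp [hd.ptr_zero], by simp, by simp, ?_, ?_,
    by simp, ?_⟩
  · intro q hq; interval_cases q <;> simp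
  · exact ⟨by simp, by simp, by simp [lastEdge], by simp, by simp⟩
  · exact ⟨by simp, by simp⟩
  · intro F; simp [columnSum, entrySum, hd.ptr_zero]

/-- The program that decides strong structural controllability. -/
def program : Prog :=
  setup ;; .loop 17 buildBody ;; .add 17 12 11 ;; .loop 17 peelBody ;;
  .cond 14 (.const 0 0) (.const 0 1)

theorem BuildInv.peelInv {B n m ν : ℕ} {sb s ro co g : ℕ → ℕ} {A : ℕ → ℕ → ℕ}
    (h : BuildInv B n m ν sb s m ν ro co g A) (hnm : n ≤ m) :
    PeelInv B (2 * n) (2 * m) (2 * ν + n) ro co (Finset.range (2 * n))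
      (2 * (2 * ν + n) + 2 * m) g A := by
  have e : min m n = n := min_eq_right hnm
  have hE := h.edges
  have hC := h.counts
  rw [e] at hE hC
  have hL : liveEdges (2 * ν + n) ro (Finset.range (2 * n)) (g 13) (g 12) =
      Finset.range (2 * ν + n) := by
    refine Finset.filter_true_of_mem fun ε hε => .inl ?_
    exact Finset.mem_range.2 (hE.row_lt ε (Finset.mem_range.1 hε))
  refine ⟨h.bases, h.reg6, hE, hL ▸ hC, subset_rfl, .inl h.reg12, by simp [h.reg12],
    .inl h.reg12, ?_, ?_, ?_, ?_, by simp [h.reg14], fun V hV _ => hV⟩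
  · rw [hL, h.reg11, Finset.card_range]
  · rw [hL, h.reg11, Finset.card_range]
  · intro k hk
    rw [h.reg11] at hk
    obtain ⟨h1, h2⟩ := h.stack (k / 2) (by omega)
    rcases Nat.even_or_odd' k with ⟨j, rfl | rfl⟩
    · rw [show 2 * j / 2 = j by omega] at h1; omega
    · rw [show (2 * j + 1) / 2 = j by omega] at h2; omega
  -- All `2 m` columns are on the stack at first, whatever their counts.
  · intro j hj _
    left
    rw [h.reg11]
    by_cases hjm : j < m
    · exact ⟨2 * j, by omega, (h.stack j hjm).1⟩
    · exact ⟨2 * (j - m) + 1, by omega, by rw [(h.stack (j - m) (by omega)).2]; omega⟩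

/-! ### The complete program: correctness and running time -/

theorem exec_program {W B n r m ν : ℕ} {sb s low : ℕ → ℕ}
    (hd : InputData n m ν sb s low) (hm : m = n + r) (hn : 1 ≤ n) (h0 : low 0 = n) (h1 : low 1 = r)
    (hB : B = m + ν + 3) (hW : 8 * (2 * n + 2 * m + (2 * ν + n) + 1) + B + 5 ≤ W) :
    ∃ t τ, Exec W program ⟨fun _ => 0, layout B low fun _ _ => 0⟩ t τ ∧
      t ≤ setup.len + ((buildBody.len + 1) * (ν + m) + 1) + 1 +
        ((peelBody.len + 1) * (2 * (2 * ν + n) + 2 * m) + 1) + 2 ∧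
      (τ.reg 0 = 0 ∨ τ.reg 0 = 1) ∧
      (τ.reg 0 = 1 ↔ ∀ V ⊆ Finset.range (2 * n), V.Nonempty → ∃ j < 2 * m,
        columnSum n m sb s (fun i j' => if i ∈ V ∧ j' = j then 1 else 0) m = 1) := by
  obtain ⟨t₁, _, hx₁, ht₁, g, rfl, hg⟩ := Prog.exec_of_wp (W := W) (p := setup)
    (Q := fun σ => ∃ g, σ = ⟨g, layout B low fun _ _ => 0⟩ ∧
      BuildInv B n m ν sb s 0 0 (fun _ => 0) (fun _ => 0) g (fun _ _ => 0))
    (wp_setup hd hm hn h0 h1 hB hW fun g hg => ⟨g, rfl, hg⟩)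
  obtain ⟨t₂, ro, co, g₂, A, hx₂, ht₂, hg₂⟩ := exec_build hd hB hW hg
  have hp := (hg₂.peelInv hd.le).congr (g' := Function.update g₂ 17 (g₂ 12 + g₂ 11))
    fun a ha => Function.update_of_ne ha _ _
  obtain ⟨t₄, τ, hx₄, ht₄, hτ⟩ := exec_peel (low := low) hW hp (by simp)
  have hx₃ : Exec W (.add 17 12 11) ⟨g₂, layout B low A⟩ 1 _ :=
    .add 17 12 11 _ (by simp [hg₂.reg12, hg₂.reg11]; omega)
  have hsum : ∀ V j, edgeCount (2 * ν + n) ro co V j =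
      columnSum n m sb s (fun i j' => if i ∈ V ∧ j' = j then 1 else 0) m := by
    intro V j
    have := hg₂.sum fun i j' => if i ∈ V ∧ j' = j then 1 else 0
    rw [min_eq_right hd.le, hd.ptr_last] at this
    simpa [edgeCount, entrySum] using this
  simp only [hsum] at hτ
  have hfin : ∃ t₅ σ, Exec W (.cond 14 (.const 0 0) (.const 0 1)) τ t₅ σ ∧ t₅ ≤ 2 ∧
      (σ.reg 0 = 0 ∨ σ.reg 0 = 1) ∧ (σ.reg 0 = 1 ↔ τ.reg 14 = 0) := by
    rcases Nat.eq_zero_or_pos (τ.reg 14) with h | h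
    · exact ⟨_, _, .cond_zero _ _ _ _ _ _ h (.const 0 1 τ (by omega)), le_rfl,
        by simp [State.setReg], by simp [State.setReg, h]⟩
    · exact ⟨_, _, .cond_pos _ _ _ _ _ _ h (.const 0 0 τ (by omega)), le_rfl,
        by simp [State.setReg], by simp [State.setReg, h.ne']⟩
  obtain ⟨t₅, σ, hx₅, ht₅, h01, hσ⟩ := hfin
  exact ⟨_, σ, .seq _ _ _ _ _ _ _ hx₁ (.seq _ _ _ _ _ _ _ hx₂ (.seq _ _ _ _ _ _ _ hx₃
    (.seq _ _ _ _ _ _ _ hx₄ hx₅))), by omega, h01, hσ.trans hτ⟩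

end RAM

/-! ## Compressed column storage -/

/-- Every nonempty set `V` of rows has a column in which the rows `V` of `𝒳 + δ I`, with `∗` read
as `1`, sum up to `1`. -/
def IsPeelable {n m : ℕ} (δ : ℕ) (𝒳 : StructMatrix n m) : Prop :=
  ∀ V : Finset (Fin n), V.Nonempty → ∃ j : Fin m,
    ∑ i ∈ V, ((if 𝒳 i j = true then 1 else 0) + if (i : ℕ) = j then δ else 0) = 1

section CCS

variable {n m : ℕ} {𝒳 : StructMatrix n m} {colPtr rowIdx : List ℕ}

theorem starsBefore_zero (𝒳 : StructMatrix n m) : starsBefore 𝒳 0 = 0 := by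
  simp [starsBefore]

theorem starsBefore_last (𝒳 : StructMatrix n m) : starsBefore 𝒳 m = numStars 𝒳 := by
  simp [starsBefore, numStars]

theorem starsBefore_mono (𝒳 : StructMatrix n m) : Monotone (starsBefore 𝒳) := by
  intro j j' h
  refine Finset.card_le_card fun p hp => ?_
  simp only [Finset.mem_filter, Finset.mem_univ, true_and] at hp ⊢
  exact ⟨hp.1.trans_le h, hp.2⟩

theorem starsBefore_succ (𝒳 : StructMatrix n m) (j : Fin m) :
    starsBefore 𝒳 (j + 1) =
      starsBefore 𝒳 j + (Finset.univ.filter fun i => 𝒳 i j = true).card := by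
  rw [starsBefore, starsBefore,
    ← Finset.card_image_of_injective (Finset.univ.filter fun i => 𝒳 i j = true)
      (f := fun i => (i, j)) fun _ _ h => (Prod.ext_iff.1 h).1,
    ← Finset.card_union_of_disjoint]
  · congr 1
    ext ⟨i, j'⟩
    simp only [Finset.mem_filter, Finset.mem_univ, true_and, Finset.mem_union, Finset.mem_image,
      Prod.mk.injEq, Nat.lt_succ_iff_lt_or_eq]
    constructor
    · rintro ⟨h | h, hx⟩
      · exact .inl ⟨h, hx⟩
      · obtain rfl := Fin.ext h
        exact .inr ⟨i, hx, rfl, rfl⟩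
    · rintro (⟨h, hx⟩ | ⟨i', hx, rfl, rfl⟩)
      · exact ⟨.inl h, hx⟩
      · exact ⟨.inr rfl, hx⟩
  · rw [Finset.disjoint_left]
    rintro ⟨i, j'⟩ h1 h2
    simp only [Finset.mem_filter, Finset.mem_univ, true_and, Finset.mem_image,
      Prod.mk.injEq] at h1 h2
    obtain ⟨_, _, _, rfl⟩ := h2
    exact lt_irrefl _ h1.1

/-- The positions of a column enumerate the `∗`-entries of the column. -/
theorem IsCCS.image_column (h : IsCCS 𝒳 colPtr rowIdx) (j : Fin m) :
    Set.InjOn (fun k => rowIdx.getD k 0)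
        (Finset.Ico (starsBefore 𝒳 j) (starsBefore 𝒳 (j + 1)) : Finset ℕ) ∧
      (Finset.Ico (starsBefore 𝒳 j) (starsBefore 𝒳 (j + 1))).image (fun k => rowIdx.getD k 0) =
        (Finset.univ.filter fun i => 𝒳 i j = true).image fun i : Fin n => (i : ℕ) + 1 := by
  set S := Finset.Ico (starsBefore 𝒳 j) (starsBefore 𝒳 (j + 1)) with hS
  set T := (Finset.univ.filter fun i => 𝒳 i j = true).image fun i : Fin n => (i : ℕ) + 1 with hT
  have hsub : T ⊆ S.image fun k => rowIdx.getD k 0 := by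
    intro x hx
    obtain ⟨i, hi, rfl⟩ := Finset.mem_image.1 hx
    obtain ⟨k, hk1, hk2, hk⟩ := (h.2.2.2 i j).1 (Finset.mem_filter.1 hi).2
    refine Finset.mem_image.2 ⟨k - 1, Finset.mem_Ico.2 ⟨by omega, by omega⟩, ?_⟩
    simp [List.getD_eq_getElem?_getD, hk]
  -- The storage format does not explicitly exclude repeated row indices within a column. The number
  -- of positions equals the number of stars, so covering all stars forces injectivity.
  have hcard : T.card = S.card := by
    rw [hT, Finset.card_image_of_injective _ fun a b h => Fin.ext (Nat.succ_injective h), hS,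
      Nat.card_Ico, starsBefore_succ, Nat.add_sub_cancel_left]
  have himage : S.image (fun k => rowIdx.getD k 0) = T :=
    (Finset.eq_of_subset_of_card_le hsub (Finset.card_image_le.trans hcard.ge)).symm
  exact ⟨Finset.card_image_iff.1 (himage ▸ hcard), himage⟩

theorem IsCCS.sum_column (h : IsCCS 𝒳 colPtr rowIdx) (j : Fin m) (f : ℕ → ℕ) :
    ∑ k ∈ Finset.Ico (starsBefore 𝒳 j) (starsBefore 𝒳 (j + 1)), f (rowIdx.getD k 0 - 1) =
      ∑ i : Fin n, if 𝒳 i j = true then f i else 0 := by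
  obtain ⟨hinj, himage⟩ := h.image_column j
  rw [← Finset.sum_image (f := fun x => f (x - 1)) hinj, himage,
    Finset.sum_image fun a _ b _ h => Fin.ext (Nat.succ_injective h), Finset.sum_filter]
  simp

theorem IsCCS.exists_row (h : IsCCS 𝒳 colPtr rowIdx) {k : ℕ} (hk : k < numStars 𝒳) :
    ∃ i : Fin n, rowIdx.getD k 0 = i + 1 := by
  -- The column pointers rise from `0` to `numStars 𝒳`, so some column contains position `k`.
  obtain ⟨j, hj, hj1, hj2⟩ : ∃ j < m, starsBefore 𝒳 j ≤ k ∧ k < starsBefore 𝒳 (j + 1) := by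
    by_contra! hcon
    have : ∀ j ≤ m, starsBefore 𝒳 j ≤ k := by
      intro j
      induction j with
      | zero => intro _; rw [starsBefore_zero]; exact Nat.zero_le k
      | succ j ih => exact fun hj => hcon j hj (ih (by omega))
    have := this m le_rfl
    rw [starsBefore_last] at this
    omega
  have : rowIdx.getD k 0 ∈ (Finset.Ico (starsBefore 𝒳 j) (starsBefore 𝒳 (j + 1))).image
      fun k => rowIdx.getD k 0 := Finset.mem_image_of_mem _ (Finset.mem_Ico.2 ⟨hj1, hj2⟩)
  rw [(h.image_column ⟨j, hj⟩).2] at this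
  obtain ⟨i, -, hi⟩ := Finset.mem_image.1 this
  exact ⟨i, hi.symm⟩

theorem IsCCS.inputData (h : IsCCS 𝒳 colPtr rowIdx) (hnm : n ≤ m) (r : ℕ) :
    RAM.InputData n m (numStars 𝒳) (starsBefore 𝒳) (fun k => rowIdx.getD k 0 - 1)
      fun a => ([n, r] ++ colPtr ++ rowIdx).getD a 0 := by
  refine ⟨hnm, starsBefore_zero 𝒳, starsBefore_last 𝒳, starsBefore_mono 𝒳, fun j hj => ?_,
    fun k hk => ?_, fun k hk => ?_⟩
  · have hp := h.2.2.1 (j + 1) hj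
    have hl := h.1
    rw [List.append_assoc, List.getD_append_right _ _ _ _ (by simp; omega),
      List.getD_append _ _ _ _ (by simp; omega), List.getD_eq_getElem?_getD,
      show 3 + j - [n, r].length = j + 1 by simp; omega, hp, Option.getD_some]
  · obtain ⟨i, hi⟩ := h.exists_row hk
    have hl := h.1
    rw [List.getD_append_right _ _ _ _ (by simp; omega),
      show m + 3 + k - ([n, r] ++ colPtr).length = k by simp; omega]
    omega
  · obtain ⟨i, hi⟩ := h.exists_row hk
    have := i.2
    simp only [hi]
    omega

theorem IsCCS.columnSum_left (h : IsCCS 𝒳 colPtr rowIdx) (V : Finset ℕ) (c : Fin m) :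
    RAM.columnSum n m (starsBefore 𝒳) (fun k => rowIdx.getD k 0 - 1)
        (fun i j => if i ∈ V ∧ j = c then 1 else 0) m =
      ∑ i ∈ Finset.univ.filter (fun i : Fin n => (i : ℕ) ∈ V),
        ((if 𝒳 i c = true then 1 else 0) + if (i : ℕ) = c then 0 else 0) := by
  rw [RAM.columnSum, Finset.sum_eq_single_of_mem (c : ℕ) (Finset.mem_range.2 c.2)]
  · have := c.2
    simp only [RAM.entrySum, show ¬ m + (c : ℕ) = c by omega, and_true, and_false, if_false,
      add_zero, ite_self]
    rw [h.sum_column c fun x => if x ∈ V then 1 else 0, Finset.sum_filter]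
    refine Finset.sum_congr rfl fun i _ => ?_
    split_ifs <;> rfl
  · intro j _ hj
    have := c.2
    simp [RAM.entrySum, hj, show ¬ m + j = c by omega]

theorem IsCCS.columnSum_right (h : IsCCS 𝒳 colPtr rowIdx) (V : Finset ℕ) (c : Fin m) :
    RAM.columnSum n m (starsBefore 𝒳) (fun k => rowIdx.getD k 0 - 1)
        (fun i j => if i ∈ V ∧ j = m + c then 1 else 0) m =
      ∑ i ∈ Finset.univ.filter (fun i : Fin n => n + (i : ℕ) ∈ V),
        ((if 𝒳 i c = true then 1 else 0) + if (i : ℕ) = c then 1 else 0) := by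
  rw [RAM.columnSum, Finset.sum_eq_single_of_mem (c : ℕ) (Finset.mem_range.2 c.2)]
  · have := c.2
    simp only [RAM.entrySum, show ¬ (c : ℕ) = m + c by omega, and_true, and_false, if_false,
      zero_add]
    rw [h.sum_column c fun x => if n + x ∈ V then 1 else 0, Finset.sum_add_distrib,
      Finset.sum_filter, Finset.sum_filter]
    congr 1
    · refine Finset.sum_congr rfl fun i _ => ?_
      split_ifs <;> rfl
    · split_ifs with hc hV
      · rw [Finset.sum_eq_single_of_mem ⟨c, hc⟩ (Finset.mem_univ _)]
        · simp [hV]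
        · intro i _ hi
          rw [if_neg fun e => hi (Fin.ext e), ite_self]
      · symm
        refine Finset.sum_eq_zero fun i _ => ?_
        split_ifs with h1 h2
        · exact absurd (h2 ▸ h1) hV
        · rfl
        · rfl
      · symm
        refine Finset.sum_eq_zero fun i _ => ?_
        have := i.2
        rw [if_neg (show ¬ (i : ℕ) = c by omega), ite_self]
  · intro j hjm hj
    have := c.2
    have := Finset.mem_range.1 hjm
    simp [RAM.entrySum, hj, show ¬ j = m + c by omega]

/-- The two blocks share neither rows nor columns. A set inside one block can only be peeled by a
column of that block; conversely, a nonempty `V` meets some block, and a column that peels this part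
does not see the rest of `V`. -/
theorem IsCCS.columnSum_iff (h : IsCCS 𝒳 colPtr rowIdx) :
    (∀ V ⊆ Finset.range (2 * n), V.Nonempty → ∃ j < 2 * m,
      RAM.columnSum n m (starsBefore 𝒳) (fun k => rowIdx.getD k 0 - 1)
        (fun i j' => if i ∈ V ∧ j' = j then 1 else 0) m = 1) ↔
      IsPeelable 0 𝒳 ∧ IsPeelable 1 𝒳 := by
  constructor
  · refine fun H => ⟨fun V hV => ?_, fun V hV => ?_⟩
    · obtain ⟨j, hj, hc⟩ := H (V.image fun i : Fin n => (i : ℕ)) (fun x hx => by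
        obtain ⟨i, -, rfl⟩ := Finset.mem_image.1 hx
        exact Finset.mem_range.2 (by have := i.2; omega)) (hV.image _)
      by_cases hjm : j < m
      · refine ⟨⟨j, hjm⟩, ?_⟩
        refine Eq.trans ?_ ((h.columnSum_left _ ⟨j, hjm⟩).symm.trans hc)
        congr 1
        ext i
        simp [Fin.val_inj]
      · have e := h.columnSum_right (V.image fun i : Fin n => (i : ℕ)) ⟨j - m, by omega⟩
        simp only [show m + (j - m) = j by omega] at e
        rw [hc, Finset.filter_false_of_mem, Finset.sum_empty] at e
        · exact absurd e one_ne_zero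
        · intro i _ hi
          obtain ⟨i', -, hi'⟩ := Finset.mem_image.1 hi
          have := i'.2
          omega
    · obtain ⟨j, hj, hc⟩ := H (V.image fun i : Fin n => n + (i : ℕ)) (fun x hx => by
        obtain ⟨i, -, rfl⟩ := Finset.mem_image.1 hx
        exact Finset.mem_range.2 (by have := i.2; omega)) (hV.image _)
      by_cases hjm : j < m
      · have e := h.columnSum_left (V.image fun i : Fin n => n + (i : ℕ)) ⟨j, hjm⟩
        simp only at e
        rw [hc, Finset.filter_false_of_mem, Finset.sum_empty] at e
        · exact absurd e one_ne_zero
        · intro i _ hi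
          obtain ⟨i', -, hi'⟩ := Finset.mem_image.1 hi
          have := i.2
          omega
      · refine ⟨⟨j - m, by omega⟩, ?_⟩
        have e := h.columnSum_right (V.image fun i : Fin n => n + (i : ℕ)) ⟨j - m, by omega⟩
        simp only [show m + (j - m) = j by omega] at e
        refine Eq.trans ?_ (e.symm.trans hc)
        congr 1
        ext i
        simp [Fin.val_inj]
  · rintro ⟨h0, h1⟩ V hV ⟨v, hv⟩
    have hv2 := Finset.mem_range.1 (hV hv)
    by_cases hvn : v < n
    · obtain ⟨j, hj⟩ := h0 (Finset.univ.filter fun i : Fin n => (i : ℕ) ∈ V)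
        ⟨⟨v, hvn⟩, by simpa using hv⟩
      exact ⟨j, by have := j.2; omega, (h.columnSum_left V j).trans hj⟩
    · obtain ⟨j, hj⟩ := h1 (Finset.univ.filter fun i : Fin n => n + (i : ℕ) ∈ V)
        ⟨⟨v - n, by omega⟩, by
          simpa [show n + (v - n) = v by omega] using hv⟩
      exact ⟨m + j, by have := j.2; omega, (h.columnSum_right V j).trans hj⟩

end CCS

/-- The program decides in linear time whether both peeling conditions hold. -/
theorem RAM.exists_exec_program : ∃ C : ℕ, ∀ (n r : ℕ) (𝒳 : StructMatrix n (n + r))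
    (colPtr rowIdx : List ℕ), 1 ≤ n → IsCCS 𝒳 colPtr rowIdx → ∃ (t : ℕ) (σ : RAM.State),
      RAM.Exec (C * (n + r + numStars 𝒳)) RAM.program
        (RAM.State.init ([n, r] ++ colPtr ++ rowIdx)) t σ ∧
      t ≤ C * (n + r + numStars 𝒳) ∧ (σ.reg 0 = 0 ∨ σ.reg 0 = 1) ∧
      (σ.reg 0 = 1 ↔ IsPeelable 0 𝒳 ∧ IsPeelable 1 𝒳) := by
  -- With `S = n + r + ν ≥ 1`, the required word size is at most `41 S + 16 ≤ 57 S`. The initial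
  -- peeling potential is at most `4 S`, and the `57` also absorbs the additive constants of the
  -- running time.
  refine ⟨57 + setup.len + (buildBody.len + 1) + (peelBody.len + 1) * 4,
    fun n r 𝒳 colPtr rowIdx hn h => ?_⟩
  set low : ℕ → ℕ := fun a => ([n, r] ++ colPtr ++ rowIdx).getD a 0 with hlow
  have hinit : State.init ([n, r] ++ colPtr ++ rowIdx) =
      ⟨fun _ => 0, layout (n + r + numStars 𝒳 + 3) low fun _ _ => 0⟩ := by
    rw [State.init]
    congr 1
    funext a
    unfold layout
    split_ifs with ha
    · rfl
    · refine List.getD_eq_default _ _ ?_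
      have h1 := h.1
      have h2 := h.2.1
      simp only [List.length_append, List.length_cons, List.length_nil]
      omega
  set ν := numStars 𝒳 with hν
  set S := n + r + ν with hS
  have hS1 : 1 ≤ S := by omega
  obtain ⟨t, σ, hex, ht, h01, hσ⟩ := exec_program
    (W := (57 + setup.len + (buildBody.len + 1) + (peelBody.len + 1) * 4) * S) (B := S + 3)
    (h.inputData (by omega) r) rfl hn (by simp) (by simp) rfl (by
      have : 57 * S ≤ (57 + setup.len + (buildBody.len + 1) + (peelBody.len + 1) * 4) * S :=
        Nat.mul_le_mul_right _ (by omega)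
      refine le_trans ?_ this
      omega)
  refine ⟨t, σ, hinit ▸ hex, ?_, h01, hσ.trans h.columnSum_iff⟩
  have e1 : (buildBody.len + 1) * (ν + (n + r)) = (buildBody.len + 1) * S := by
    congr 1
    omega
  have e2 : (peelBody.len + 1) * (2 * (2 * ν + n) + 2 * (n + r)) ≤ (peelBody.len + 1) * 4 * S := by
    rw [mul_assoc]
    exact Nat.mul_le_mul_left _ (by omega)
  have e3 : setup.len ≤ setup.len * S := Nat.le_mul_of_pos_right _ hS1
  rw [← hν, e1] at ht
  rw [add_mul, add_mul, add_mul]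
  omega

open scoped Matrix

/-! ## Controllability and left eigenvectors -/

section Control

variable {𝔽 : Type*} [RCLike 𝔽] {n r : ℕ}

/-- A left eigenvector that annihilates the input matrix prevents controllability. -/
theorem not_isControllable_of_vecMul {A : Matrix (Fin n) (Fin n) 𝔽} {B : Matrix (Fin n) (Fin r) 𝔽}
    {v : Fin n → 𝔽} {μ : 𝔽} (hv : v ≠ 0) (hA : v ᵥ* A = μ • v) (hB : v ᵥ* B = 0) :
    ¬ IsControllable A B := by
  intro hc
  obtain ⟨i, hi⟩ := Function.ne_iff.1 hv
  -- The target is a unit vector that `v` does not annihilate, whereas `v ⬝ᵥ x` turns out to stay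
  -- `0` along every trajectory from `0`.
  obtain ⟨T, hT, u, hu, x, hx, hsol, hend⟩ := hc 0 (Pi.single i 1)
  let L : (Fin n → 𝔽) →L[𝔽] 𝔽 := LinearMap.toContinuousLinearMap (dotProductBilin 𝔽 𝔽 v)
  have hL : ∀ w, L w = v ⬝ᵥ w := fun w => rfl
  have huint : MeasureTheory.IntegrableOn u (Set.Icc 0 T) := hu.integrable le_top
  have hxint : MeasureTheory.IntegrableOn x (Set.Icc 0 T) := hx.integrableOn_Icc
  have hint : MeasureTheory.IntegrableOn (fun τ => A *ᵥ x τ + B *ᵥ u τ) (Set.Icc 0 T) :=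
    ((LinearMap.toContinuousLinearMap (Matrix.mulVecLin A)).integrable_comp hxint).add
      ((LinearMap.toContinuousLinearMap (Matrix.mulVecLin B)).integrable_comp huint)
  have hLx : ∀ t ∈ Set.Icc 0 T, L (x t) = ∫ τ in (0 : ℝ)..t, μ * L (x τ) := by
    intro t ht
    have hi : IntervalIntegrable (fun τ => A *ᵥ x τ + B *ᵥ u τ) MeasureTheory.volume 0 t :=
      (intervalIntegrable_iff_integrableOn_Icc_of_le ht.1).2
        (hint.mono_set (Set.Icc_subset_Icc_right ht.2))
    rw [hsol t ht, zero_add, ← L.intervalIntegral_comp_comm hi]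
    refine intervalIntegral.integral_congr fun τ _ => ?_
    simp only [hL]
    rw [dotProduct_add, Matrix.dotProduct_mulVec, Matrix.dotProduct_mulVec, hA, hB,
      zero_dotProduct, add_zero, smul_dotProduct, smul_eq_mul]
  -- A continuous extension to the whole line makes the integral of `μ * y` differentiable
  -- everywhere.
  let y : ℝ → 𝔽 := Set.IccExtend hT.le ((Set.Icc 0 T).domRestrict fun t => L (x t))
  have hy : Continuous y :=
    (continuousOn_iff_continuous_domRestrict.1 (L.continuous.comp_continuousOn hx)).Icc_extend'
  have hyL : ∀ t ∈ Set.Icc 0 T, y t = L (x t) := fun t ht => Set.IccExtend_of_mem _ _ ht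
  have hzero : ∀ t ∈ Set.Icc 0 T, ∫ τ in (0 : ℝ)..t, μ * y τ = 0 := by
    have hcont : Continuous fun τ => μ * y τ := continuous_const.mul hy
    have hderiv : ∀ t, HasDerivAt (fun t => ∫ τ in (0 : ℝ)..t, μ * y τ) (μ * y t) t := fun t =>
      (hcont.integral_hasStrictDerivAt 0 t).hasDerivAt
    -- Grönwall: the integral vanishes at `0`, and its derivative is `μ` times itself.
    refine eq_zero_of_abs_deriv_le_mul_abs_self_of_eq_zero_right (K := ‖μ‖)
      (fun t _ => (hderiv t).continuousAt.continuousWithinAt)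
      (fun t _ => (hderiv t).hasDerivWithinAt) (by simp) fun t ht => ?_
    have ht' : t ∈ Set.Icc 0 T := ⟨ht.1, ht.2.le⟩
    rw [norm_mul]
    refine le_of_eq ?_
    congr 2
    rw [hyL t ht', hLx t ht']
    refine intervalIntegral.integral_congr fun τ hτ => ?_
    rw [Set.uIcc_of_le ht.1] at hτ
    rw [hyL τ ⟨hτ.1, hτ.2.trans ht.2.le⟩]
  have hT' : T ∈ Set.Icc 0 T := ⟨hT.le, le_rfl⟩
  have h0 : L (x T) = 0 := by
    rw [hLx T hT', ← hzero T hT']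
    refine intervalIntegral.integral_congr fun τ hτ => ?_
    rw [Set.uIcc_of_le hT.le] at hτ
    rw [hyL τ hτ]
  rw [hend, hL] at h0
  exact hi (by simpa using h0)

/-- The matrix exponential, with the properties that the solution of linear systems needs. -/
theorem exists_matrix_exp (A : Matrix (Fin n) (Fin n) 𝔽) :
    ∃ e : ℝ → Matrix (Fin n) (Fin n) 𝔽, e 0 = 1 ∧ (∀ t, e t * e (-t) = 1) ∧
      (∀ t, A * e t = e t * A) ∧ ∀ t i j, HasDerivAt (fun t => e t i j) ((A * e t) i j) t := by
  let _ : NormedRing (Matrix (Fin n) (Fin n) 𝔽) := Matrix.linftyOpNormedRing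
  let _ : NormedAlgebra ℝ (Matrix (Fin n) (Fin n) 𝔽) := Matrix.linftyOpNormedAlgebra
  refine ⟨fun t => NormedSpace.exp (t • A), by simp, fun t => ?_, fun t => ?_, fun t i j => ?_⟩
  · rw [← Matrix.exp_add_of_commute _ _ ((Commute.refl A).smul_left t |>.smul_right (-t))]
    simp
  · exact ((Commute.refl A).smul_right t).exp_right
  · have h := hasDerivAt_exp_smul_const' (𝕂 := ℝ) A t
    exact ((Matrix.entryLinearMap ℝ 𝔽 i j).toContinuousLinearMap.hasFDerivAt.comp_hasDerivAt t h :)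

/-- The product rule, with entrywise derivatives, so that no norm on matrices has to be fixed. -/
theorem hasDerivAt_bilinear {e : ℝ → Matrix (Fin n) (Fin n) 𝔽} {E : Matrix (Fin n) (Fin n) 𝔽}
    {t : ℝ} (he : ∀ i j, HasDerivAt (fun t => e t i j) (E i j) t) {w : ℝ → Fin n → 𝔽}
    {W : Fin n → 𝔽} (hw : HasDerivAt w W t) :
    HasDerivAt (fun t => e t *ᵥ w t) (E *ᵥ w t + e t *ᵥ W) t := by
  refine hasDerivAt_pi.2 fun i => ?_
  have := HasDerivAt.fun_sum (u := Finset.univ) fun j _ => (he i j).mul (hasDerivAt_pi.1 hw j)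
  simpa [Matrix.mulVec, dotProduct, Finset.sum_add_distrib] using this

theorem continuous_of_hasDerivAt_entries {e E : ℝ → Matrix (Fin n) (Fin n) 𝔽}
    (he : ∀ t i j, HasDerivAt (fun t => e t i j) (E t i j) t) : Continuous e :=
  continuous_matrix fun i j => continuous_iff_continuousAt.2 fun t => (he t i j).continuousAt

/-- The Kalman condition implies controllability. -/
theorem isControllable_of_kalman (A : Matrix (Fin n) (Fin n) 𝔽) (B : Matrix (Fin n) (Fin r) 𝔽)
    (h : ∀ v : Fin n → 𝔽, (∀ k : ℕ, v ᵥ* A ^ k ᵥ* B = 0) → v = 0) : IsControllable A B := by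
  obtain ⟨e, he0, hinv, hcomm, hderiv⟩ := exists_matrix_exp A
  have hcont : Continuous e := continuous_of_hasDerivAt_entries hderiv
  have hinv' : ∀ t, e (-t) * e t = 1 := fun t => by simpa using hinv (-t)
  have hcneg : Continuous fun t => e (-t) := hcont.comp continuous_neg
  have hint : ∀ u : C(ℝ, Fin r → 𝔽), Continuous fun τ => e (-τ) *ᵥ (B *ᵥ u τ) := fun u =>
    hcneg.matrix_mulVec (continuous_const.matrix_mulVec u.continuous)
  -- By variation of constants, steering `x₀` to `x₁` in time `1` means solving `R u = e (-1) *ᵥ x₁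
  -- - x₀`; so surjectivity of `R` suffices.
  let R : C(ℝ, Fin r → 𝔽) →ₗ[𝔽] (Fin n → 𝔽) :=
    { toFun := fun u => ∫ τ in (0 : ℝ)..1, e (-τ) *ᵥ (B *ᵥ u τ)
      map_add' := fun u w => by
        rw [← intervalIntegral.integral_add ((hint u).intervalIntegrable _ _)
          ((hint w).intervalIntegrable _ _)]
        simp [Matrix.mulVec_add]
      map_smul' := fun c u => by
        simp [Matrix.mulVec_smul, intervalIntegral.integral_smul] }
  have hR : LinearMap.range R = ⊤ := by
    by_contra hne
    obtain ⟨φ, hφ0, hφ⟩ := Submodule.exists_le_ker_of_lt_top _ (lt_top_iff_ne_top.2 hne)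
    obtain ⟨v, hφv⟩ : ∃ v : Fin n → 𝔽, ∀ w, φ w = v ⬝ᵥ w := by
      refine ⟨fun i => φ fun j => if i = j then 1 else 0, fun w => ?_⟩
      rw [LinearMap.pi_apply_eq_sum_univ φ w]
      exact Finset.sum_congr rfl fun i _ => mul_comm _ _
    have hv : v ≠ 0 := by
      rintro rfl
      exact hφ0 (LinearMap.ext fun w => by simp [hφv])
    have hzero : ∀ s ∈ Set.Icc (0 : ℝ) 1, v ᵥ* e (-s) ᵥ* B = 0 := by
      have hcu : Continuous fun s => v ᵥ* e (-s) ᵥ* B :=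
        (continuous_const.matrix_vecMul hcneg).matrix_vecMul continuous_const
      -- For this input, the functional `v` applied to `R u` is the integral of the squared norm of
      -- `v ᵥ* e (-s) ᵥ* B`, which must therefore vanish.
      let u : C(ℝ, Fin r → 𝔽) := ⟨fun s => star (v ᵥ* e (-s) ᵥ* B), hcu.star⟩
      have hu : φ (R u) = 0 := hφ (LinearMap.mem_range_self R u)
      have hre : ∀ s, v ⬝ᵥ (e (-s) *ᵥ (B *ᵥ u s)) =
          ((∑ l, ‖(v ᵥ* e (-s) ᵥ* B) l‖ ^ 2 : ℝ) : 𝔽) := by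
        intro s
        rw [Matrix.dotProduct_mulVec, Matrix.dotProduct_mulVec]
        simp [u, dotProduct, RCLike.mul_conj]
      have hcn : Continuous fun s => ∑ l, ‖(v ᵥ* e (-s) ᵥ* B) l‖ ^ 2 :=
        continuous_finsetSum _ fun l _ => ((continuous_apply l).comp hcu).norm.pow 2
      have hI : ∫ s in (0 : ℝ)..1, ∑ l, ‖(v ᵥ* e (-s) ᵥ* B) l‖ ^ 2 = 0 := by
        have h1 : φ (R u) = ∫ s in (0 : ℝ)..1, v ⬝ᵥ (e (-s) *ᵥ (B *ᵥ u s)) := by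
          have := φ.toContinuousLinearMap.intervalIntegral_comp_comm
            ((hint u).intervalIntegrable (μ := MeasureTheory.volume) 0 1)
          simp only [LinearMap.coe_toContinuousLinearMap', hφv] at this
          rw [hφv]
          exact this.symm
        simp only [hre] at h1
        have h2 := (RCLike.ofRealCLM (K := 𝔽)).intervalIntegral_comp_comm
          (hcn.intervalIntegrable (μ := MeasureTheory.volume) 0 1)
        simp only [RCLike.ofRealCLM_apply] at h2
        rw [hu, h2] at h1
        exact_mod_cast h1.symm
      intro s hs
      by_contra hne
      obtain ⟨l, hl⟩ := Function.ne_iff.1 hne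
      refine absurd hI (ne_of_gt (intervalIntegral.integral_pos zero_lt_one hcn.continuousOn
        (fun s _ => by positivity) ⟨s, hs, ?_⟩))
      refine Finset.sum_pos' (fun l _ => by positivity) ⟨l, Finset.mem_univ l, ?_⟩
      have : 0 < ‖(v ᵥ* e (-s) ᵥ* B) l‖ := norm_pos_iff.2 hl
      positivity
    -- Each differentiation of the vanishing function in `s` produces one more factor `A`; an open
    -- interval is needed for that.
    have hpow : ∀ k : ℕ, ∀ s ∈ Set.Ioo (-1 : ℝ) 0, ∀ z,
        v ᵥ* A ^ k ⬝ᵥ (e s *ᵥ (B *ᵥ z)) = 0 := by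
      intro k
      induction k with
      | zero =>
        intro s hs z
        have := hzero (-s) ⟨by linarith [hs.2], by linarith [hs.1]⟩
        rw [neg_neg] at this
        rw [pow_zero, Matrix.vecMul_one, Matrix.dotProduct_mulVec, Matrix.dotProduct_mulVec, this,
          zero_dotProduct]
      | succ k ih =>
        intro s hs z
        have h1 := hasDerivAt_bilinear (hderiv s) (hasDerivAt_const s (B *ᵥ z))
        rw [Matrix.mulVec_zero, add_zero] at h1
        have h2 := HasDerivAt.fun_sum (u := Finset.univ) fun i _ =>
          (hasDerivAt_pi.1 h1 i).const_mul ((v ᵥ* A ^ k) i)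
        have h3 : HasDerivAt (fun s => v ᵥ* A ^ k ⬝ᵥ (e s *ᵥ (B *ᵥ z))) 0 s := by
          refine (hasDerivAt_const s (0 : 𝔽)).congr_of_eventuallyEq ?_
          filter_upwards [Ioo_mem_nhds hs.1 hs.2] with s' hs' using ih s' hs' z
        have h4 : v ᵥ* A ^ k ⬝ᵥ ((A * e s) *ᵥ (B *ᵥ z)) = 0 := h2.unique h3
        rwa [← Matrix.mulVec_mulVec, Matrix.dotProduct_mulVec, Matrix.vecMul_vecMul,
          ← pow_succ] at h4
    -- The Kalman hypothesis is applied at an interior time, to `v ᵥ* e (-(1 / 2))`; invertibility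
    -- of the exponential then gives `v = 0`.
    have hv' : v ᵥ* e (-(1 / 2)) = 0 := by
      refine h _ fun k => dotProduct_eq_zero _ fun z => ?_
      rw [Matrix.vecMul_vecMul v,
        ← ((show Commute A (e (-(1 / 2))) from hcomm _).pow_left k).eq, ← Matrix.vecMul_vecMul v,
        ← Matrix.dotProduct_mulVec, ← Matrix.dotProduct_mulVec]
      exact hpow k _ (by norm_num) z
    apply hv
    rw [← Matrix.vecMul_one v, ← hinv' (1 / 2), ← Matrix.vecMul_vecMul, hv', Matrix.zero_vecMul]
  intro x₀ x₁
  obtain ⟨u, hu⟩ : ∃ u, R u = e (-1) *ᵥ x₁ - x₀ := by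
    rw [← LinearMap.mem_range, hR]; trivial
  let w : ℝ → Fin n → 𝔽 := fun t => x₀ + ∫ τ in (0 : ℝ)..t, e (-τ) *ᵥ (B *ᵥ u τ)
  have hw : ∀ t, HasDerivAt w (e (-t) *ᵥ (B *ᵥ u t)) t := fun t =>
    ((hint u).integral_hasStrictDerivAt 0 t).hasDerivAt.const_add x₀
  have hx : ∀ t, HasDerivAt (fun t => e t *ᵥ w t) (A *ᵥ (e t *ᵥ w t) + B *ᵥ u t) t := by
    intro t
    have := hasDerivAt_bilinear (hderiv t) (hw t)
    rwa [Matrix.mulVec_mulVec, hinv, Matrix.one_mulVec, ← Matrix.mulVec_mulVec] at this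
  have hxc : Continuous fun t => e t *ᵥ w t :=
    continuous_iff_continuousAt.2 fun t => (hx t).continuousAt
  have hw0 : w 0 = x₀ := by simp [w]
  refine ⟨1, one_pos, u, ?_, fun t => e t *ᵥ w t, hxc.continuousOn, fun t _ => ?_, ?_⟩
  · obtain ⟨C, hC⟩ := isCompact_Icc.exists_bound_of_continuousOn (s := Set.Icc (0 : ℝ) 1)
      u.continuous.continuousOn
    refine MeasureTheory.memLp_top_of_bound u.continuous.aestronglyMeasurable C ?_
    exact (MeasureTheory.ae_restrict_iff' measurableSet_Icc).2 (.of_forall hC)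
  · rw [intervalIntegral.integral_eq_sub_of_hasDerivAt (fun τ _ => hx τ)
      (((continuous_const.matrix_mulVec hxc).add
        (continuous_const.matrix_mulVec u.continuous)).intervalIntegrable _ _), hw0, he0,
      Matrix.one_mulVec]
    abel
  · have : w 1 = e (-1) *ᵥ x₁ := by
      change x₀ + R u = _
      rw [hu]; abel
    simp only [this]
    rw [Matrix.mulVec_mulVec, hinv, Matrix.one_mulVec]

/-- If a pair is not controllable, there is a complex left eigenvector that annihilates the input
matrix. -/
theorem exists_left_eigenvector (f : 𝔽 →+* ℂ) {A : Matrix (Fin n) (Fin n) 𝔽}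
    {B : Matrix (Fin n) (Fin r) 𝔽} (h : ¬ IsControllable A B) :
    ∃ (v : Fin n → ℂ) (μ : ℂ), v ≠ 0 ∧ v ᵥ* A.map f = μ • v ∧ v ᵥ* B.map f = 0 := by
  obtain ⟨v, hv, hv0⟩ : ∃ v : Fin n → 𝔽, (∀ k : ℕ, v ᵥ* A ^ k ᵥ* B = 0) ∧ v ≠ 0 := by
    by_contra! hcon
    exact h (isControllable_of_kalman A B hcon)
  -- The complex unobservable subspace of the transposed pair: it is invariant under `A` and
  -- annihilates `B`. It contains the image of `v`, so `A` has an eigenvector in it.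
  let U : Submodule ℂ (Fin n → ℂ) :=
    { carrier := {w | ∀ k : ℕ, w ᵥ* (A.map f) ^ k ᵥ* B.map f = 0}
      add_mem' := fun {a b} ha hb k => by
        rw [Matrix.add_vecMul, Matrix.add_vecMul, ha k, hb k, add_zero]
      zero_mem' := fun k => by simp
      smul_mem' := fun c w hw k => by
        rw [Matrix.smul_vecMul, Matrix.smul_vecMul, hw k, smul_zero] }
  have hU : ∀ w ∈ U, (A.map f).vecMulLinear w ∈ U := by
    intro w hw k
    have := hw (k + 1)
    rwa [pow_succ', ← Matrix.vecMul_vecMul] at this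
  have hfv : (fun i => f (v i)) ∈ U := by
    intro k
    have h1 : ∀ i j, ((A.map f) ^ k) i j = f ((A ^ k) i j) := fun i j => by
      rw [← Matrix.map_pow]; rfl
    have h2 := hv k
    funext l
    have h3 := congrArg f (congrFun h2 l)
    simpa [Matrix.vecMul, dotProduct, h1, map_sum, map_mul] using h3
  have : Nontrivial U := by
    refine ⟨⟨⟨_, hfv⟩, 0, fun h => hv0 ?_⟩⟩
    funext i
    have := congrFun (congrArg Subtype.val h) i
    exact f.injective (by simpa using this)
  obtain ⟨μ, hμ⟩ := Module.End.exists_eigenvalue ((A.map f).vecMulLinear.restrict hU)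
  obtain ⟨w, hw⟩ := hμ.exists_hasEigenvector
  refine ⟨w, μ, fun h => hw.2 (Subtype.ext h), ?_, ?_⟩
  · exact congrArg Subtype.val hw.apply_eq_smul
  · simpa using w.2 0

end Control

/-! ## Peeling and strong structural controllability -/

/-- Nonzero numbers with sum `0` or `1` exist, unless this fails for a trivial reason. -/
theorem exists_ne_zero_sum_eq {ι 𝔽 : Type*} [DecidableEq ι] [Field 𝔽] [CharZero 𝔽] (S : Finset ι)
    {d : ℕ} (hd : d ≤ 1) (h : S.card + d ≠ 1) :
    ∃ c : ι → 𝔽, (∀ i, c i ≠ 0) ∧ ∑ i ∈ S, c i = d := by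
  rcases S.eq_empty_or_nonempty with rfl | hS
  · exact ⟨fun _ => 1, fun _ => one_ne_zero, by
      have : d = 0 := by simp at h; omega
      simp [this]⟩
  have hpos := hS.card_pos
  have hne : (S.card : 𝔽) ≠ 0 := Nat.cast_ne_zero.2 hpos.ne'
  interval_cases d
  · obtain ⟨i₀, hi₀⟩ := hS
    have hne' : ((S.card : 𝔽) - 1) ≠ 0 := by
      rw [sub_ne_zero, ← Nat.cast_one]
      exact fun e => h (by rw [Nat.cast_injective e])
    refine ⟨Function.update (fun _ => 1) i₀ (-((S.card : 𝔽) - 1)), fun i => ?_, ?_⟩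
    · rw [Function.update_apply]
      split_ifs
      · exact neg_ne_zero.2 hne'
      · exact one_ne_zero
    · rw [Finset.sum_update_of_mem hi₀, Finset.sum_const, nsmul_one, Finset.sdiff_singleton_eq_erase,
        Finset.card_erase_of_mem hi₀, Nat.cast_sub hpos]
      simp
  · refine ⟨fun _ => (S.card : 𝔽)⁻¹, fun _ => inv_ne_zero hne, ?_⟩
    rw [Finset.sum_const, nsmul_eq_mul, mul_inv_cancel₀ hne, Nat.cast_one]

/-! ### The combinatorial criterion for strong structural controllability -/

section

variable {n r : ℕ} {𝒜 : StructMatrix n n} {ℬ : StructMatrix n r}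

/-- For an obstruction `V`, the entries of each column are chosen with sum `d` or `0` over `V`,
according to whether the column index lies in `V`. This makes the indicator of `V` a left
eigenvector with eigenvalue `d` that annihilates `B`. -/
theorem isPeelable_of_strongStructControllable {𝔽 : Type*} [RCLike 𝔽]
    (h : StrongStructControllable 𝔽 𝒜 ℬ) {d : ℕ} (hd : d ≤ 1) : IsPeelable d (pairMatrix 𝒜 ℬ) := by
  by_contra hcon
  simp only [IsPeelable, not_forall, not_exists, exists_prop] at hcon
  obtain ⟨V, hV, hcon⟩ := hcon
  have key : ∀ j : Fin (n + r), ∃ c : Fin n → 𝔽, (∀ i, c i ≠ 0) ∧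
      ∑ i ∈ V, (if pairMatrix 𝒜 ℬ i j = true then c i else 0) =
        ((∑ i ∈ V, if (i : ℕ) = j then d else 0 : ℕ) : 𝔽) := by
    intro j
    have hle : (∑ i ∈ V, if (i : ℕ) = j then d else 0) ≤ 1 := by
      by_cases hj : (j : ℕ) < n
      · calc _ ≤ ∑ i : Fin n, if (i : ℕ) = j then d else 0 :=
              Finset.sum_le_sum_of_subset (Finset.subset_univ V)
          _ = d := by
              rw [Finset.sum_eq_single_of_mem ⟨j, hj⟩ (Finset.mem_univ _) fun i _ hi =>
                if_neg fun e => hi (Fin.ext e), if_pos rfl]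
          _ ≤ 1 := hd
      · rw [Finset.sum_eq_zero fun i _ => if_neg (by have := i.2; omega)]
        exact Nat.zero_le 1
    have hne := hcon j
    rw [Finset.sum_add_distrib, ← Finset.card_filter] at hne
    obtain ⟨c, hc0, hc⟩ := exists_ne_zero_sum_eq (𝔽 := 𝔽) _ hle hne
    exact ⟨c, hc0, by rw [← Finset.sum_filter, hc]⟩
  choose c hc0 hc using key
  let M : Matrix (Fin n) (Fin (n + r)) 𝔽 := fun i j =>
    if pairMatrix 𝒜 ℬ i j = true then c j i else 0
  let A : Matrix (Fin n) (Fin n) 𝔽 := fun i j => M i (Fin.castAdd r j)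
  let B : Matrix (Fin n) (Fin r) 𝔽 := fun i j => M i (Fin.natAdd n j)
  let v : Fin n → 𝔽 := fun i => if i ∈ V then 1 else 0
  have hM : ∀ i j, M i j ≠ 0 ↔ pairMatrix 𝒜 ℬ i j = true := by
    intro i j
    simp only [M]
    split_ifs with h1
    · simp [h1, hc0]
    · simp [h1]
  have hsum : ∀ j, ∑ i, v i * M i j = ((∑ i ∈ V, if (i : ℕ) = j then d else 0 : ℕ) : 𝔽) := by
    intro j
    rw [← hc j]
    simp only [v, M, ite_mul, one_mul, zero_mul, Finset.sum_ite_mem, Finset.univ_inter]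
  refine not_isControllable_of_vecMul (A := A) (B := B) (v := v) (μ := (d : 𝔽)) ?_ ?_ ?_
    (h A B (fun i j => ?_) fun i j => ?_)
  · obtain ⟨i, hi⟩ := hV
    exact fun e => one_ne_zero (α := 𝔽) (by simpa [v, hi] using congrFun e i)
  · funext j
    have : (v ᵥ* A) j = ∑ i, v i * M i (Fin.castAdd r j) := rfl
    rw [this, hsum]
    simp [v, Fin.val_inj]
  · funext j
    have : (v ᵥ* B) j = ∑ i, v i * M i (Fin.natAdd n j) := rfl
    rw [this, hsum, Finset.sum_eq_zero fun i _ => if_neg ?_]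
    · simp
    · have := i.2
      simp only [Fin.val_natAdd]
      omega
  · simpa [pairMatrix] using hM i (Fin.castAdd r j)
  · simpa [pairMatrix] using hM i (Fin.natAdd n j)

/-- The support of a left eigenvector obstructs peeling. -/
theorem sum_mul_ne_of_column {n : ℕ} {v a : Fin n → ℂ} {star : Fin n → Prop} [DecidablePred star]
    {d : ℕ} {μ : ℂ} (ha : ∀ i, a i ≠ 0 ↔ star i) (hμ : μ = 0 ↔ d = 0)
    (h : (∑ i ∈ Finset.univ.filter fun i => v i ≠ 0, if star i then 1 else 0) + d = 1) :
    ∑ i, v i * a i ≠ μ := by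
  set S := (Finset.univ.filter fun i => v i ≠ 0).filter star with hS
  have hsupp : ∀ i, v i * a i ≠ 0 ↔ i ∈ S := by
    intro i
    simp [hS, ← ha]
  rw [← Finset.card_filter, ← hS] at h
  rw [← Finset.sum_subset (Finset.subset_univ S) fun i _ hi =>
    not_not.1 fun h0 => hi ((hsupp i).1 h0)]
  rcases Nat.eq_zero_or_pos d with hd | hd
  · obtain ⟨i, hi⟩ := Finset.card_eq_one.1 (show S.card = 1 by omega)
    rw [hμ.2 hd, hi, Finset.sum_singleton]
    exact (hsupp i).2 (hi ▸ Finset.mem_singleton_self i)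
  · rw [Finset.card_eq_zero.1 (show S.card = 0 by omega), Finset.sum_empty]
    exact fun e => hd.ne' (hμ.1 e.symm)

/-- Of a left eigenvector, only its support and whether its eigenvalue is `0` matter: the column
given by peeling contradicts the eigenvector equation in that column. The eigenvector may be complex
even over `ℝ`, whence the embedding `f`. -/
theorem strongStructControllable_of_isPeelable {𝔽 : Type*} [RCLike 𝔽] (f : 𝔽 →+* ℂ)
    (h0 : IsPeelable 0 (pairMatrix 𝒜 ℬ)) (h1 : IsPeelable 1 (pairMatrix 𝒜 ℬ)) :
    StrongStructControllable 𝔽 𝒜 ℬ := by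
  intro A B hA hB
  by_contra hcon
  obtain ⟨v, μ, hv, hvA, hvB⟩ := exists_left_eigenvector f hcon
  obtain ⟨d, hd, hμ⟩ : ∃ d : ℕ, IsPeelable d (pairMatrix 𝒜 ℬ) ∧ d ≤ 1 ∧ (μ = 0 ↔ d = 0) := by
    by_cases hμ : μ = 0
    · exact ⟨0, h0, zero_le_one, by simp [hμ]⟩
    · exact ⟨1, h1, le_rfl, by simp [hμ]⟩
  obtain ⟨hd1, hμ⟩ := hμ
  obtain ⟨i₀, hi₀⟩ := Function.ne_iff.1 hv
  obtain ⟨j, hj⟩ := hd (Finset.univ.filter fun i => v i ≠ 0) ⟨i₀, by simpa using hi₀⟩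
  rw [Finset.sum_add_distrib] at hj
  induction j using Fin.addCases with
  | left j =>
    have hsum : ∑ i, v i * f (A i j) = μ * v j := congrFun hvA j
    have hdj : (∑ i ∈ Finset.univ.filter fun i => v i ≠ 0,
        if (i : ℕ) = (Fin.castAdd r j : Fin (n + r)) then d else 0) = if v j = 0 then 0 else d := by
      simp [Fin.val_inj, Finset.sum_ite_eq']
    rw [hdj] at hj
    -- The product `μ * v j` vanishes exactly if the diagonal contribution, which is `d` for `v j ≠
    -- 0` and `0` otherwise, does.
    refine sum_mul_ne_of_column (v := v) (fun i => ?_) ?_ hj hsum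
    · simpa [pairMatrix] using hA i j
    · by_cases hvj : v j = 0 <;> simp [hvj, hμ]
  | right j =>
    have hsum : ∑ i, v i * f (B i j) = 0 := congrFun hvB j
    have hdj : (∑ i ∈ Finset.univ.filter fun i => v i ≠ 0,
        if (i : ℕ) = (Fin.natAdd n j : Fin (n + r)) then d else 0) = 0 :=
      Finset.sum_eq_zero fun i _ => if_neg (by
        have := i.2
        simp only [Fin.val_natAdd]
        omega)
    rw [hdj] at hj
    refine sum_mul_ne_of_column (v := v) (fun i => ?_) (by simp) hj hsum
    simpa [pairMatrix] using hB i j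

theorem strongStructControllable_iff {𝔽 : Type*} [RCLike 𝔽] (f : 𝔽 →+* ℂ) :
    StrongStructControllable 𝔽 𝒜 ℬ ↔
      IsPeelable 0 (pairMatrix 𝒜 ℬ) ∧ IsPeelable 1 (pairMatrix 𝒜 ℬ) :=
  ⟨fun h => ⟨isPeelable_of_strongStructControllable h zero_le_one,
    isPeelable_of_strongStructControllable h le_rfl⟩,
    fun h => strongStructControllable_of_isPeelable f h.1 h.2⟩

end

theorem mainTheorem1 :
    ∃ (P : RAM.Prog) (C : ℕ),
      ∀ (n r ν : ℕ) (𝒜 : StructMatrix n n) (ℬ : StructMatrix n r) (colPtr rowIdx : List ℕ),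
        1 ≤ n →
        numStars (pairMatrix 𝒜 ℬ) = ν →
        IsCCS (pairMatrix 𝒜 ℬ) colPtr rowIdx →
        ∃ (t : ℕ) (σ : RAM.State),
          RAM.Exec (C * (n + r + ν)) P (RAM.State.init ([n, r] ++ colPtr ++ rowIdx)) t σ ∧
          t ≤ C * (n + r + ν) ∧
          (σ.reg 0 = 0 ∨ σ.reg 0 = 1) ∧
          (σ.reg 0 = 1 ↔ StrongStructControllable ℝ 𝒜 ℬ) ∧
          (σ.reg 0 = 1 ↔ StrongStructControllable ℂ 𝒜 ℬ) := by
  obtain ⟨C, hC⟩ := RAM.exists_exec_program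
  refine ⟨RAM.program, C, ?_⟩
  rintro n r _ 𝒜 ℬ colPtr rowIdx hn rfl hccs
  obtain ⟨t, σ, hex, ht, h01, hσ⟩ := hC n r _ colPtr rowIdx hn hccs
  exact ⟨t, σ, hex, ht, h01, hσ.trans (strongStructControllable_iff Complex.ofRealHom).symm,
    hσ.trans (strongStructControllable_iff (RingHom.id ℂ)).symm⟩
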